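/- There are an absolute constant $C>0$ and an integer $n_0$ such that for every $n\ge n_0$ and every $\varepsilon\in(0,1)$ there is an $\varepsilon$-differentially private (non-interactive) protocol in the shuffled model for summing $n$ inputs $x_1,\dots,x_n\in[0,1]$, in which each user sends at most $C\,\frac{\log^3 n}{\varepsilon}$ messages, each of length at most $C\log\log n$ bits, and whose expected error satisfies, for all $x_1,\dots,x_n\in[0,1]$, $$\mathbb{E}\left[\Big|A\big(S(R(x_1),\dots,R(x_n))\big)-\sum_{i=1}^n x_i\Big|\right]\;\le\; C\,\frac{\sqrt{\log(2/\varepsilon)}}{\varepsilon^{3/2}}.$$ Here a shuffled-model protocol consists of a local randomizer $R$, which every user runs independently on their own input and which outputs a finite random sequence of messages; the shuffler $S$, which outputs a uniformly random permutation of the concatenation of these sequences; and an analyzer $A$, which maps the output of the shuffler to a real number. The protocol is $\varepsilon$-differentially private if $\Pr[S(R(x_1),\dots,R(x_n))\in T]\le e^{\varepsilon}\Pr[S(R(x_1'),\dots,R(x_n'))\in T]$ for every set $T$ of sequences of messages and all inputs $(x_i)$, $(x_i')$ in $[0,1]^n$ that differ in at most one coordinate. -/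

import Mathlib

open scoped ENNReal

noncomputable section

/-- `(ε, δ)`-differential privacy of a randomized algorithm on datasets of `n` users: for any two
datasets that differ in the data of a single user and for every event `S`, the probability of `S`
grows by a factor of at most `e ^ ε`, plus `δ`. -/
def IsDP {n : ℕ} {X Y : Type*} (P : (Fin n → X) → PMF Y) (ε δ : ℝ) : Prop :=
  ∀ x x' : Fin n → X, (∃ i, ∀ j, j ≠ i → x j = x' j) → ∀ S : Set Y,
    (P x).toOuterMeasure S
      ≤ ENNReal.ofReal (Real.exp ε) * (P x').toOuterMeasure S + ENNReal.ofReal δ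

/-- The shuffler: a uniformly random permutation of a sequence of messages. -/
def shuffle {M : Type*} (l : List M) : PMF (List M) :=
  (PMF.uniformOfFintype (Equiv.Perm (Fin l.length))).map
    fun σ => List.ofFn fun i => l.get (σ i)

/-- The concatenation of the outputs of a local randomizer `R`, run independently (with fresh
private randomness) on each of the listed inputs. -/
def concatOutputs {X M : Type*} (R : X → PMF (List M)) : List X → PMF (List M)
  | [] => PMF.pure []
  | x :: xs => (R x).bind fun a => (concatOutputs R xs).map fun b => a ++ b

/-- A (non-interactive) protocol in the shuffled model with inputs in `X`, messages in `M` and a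
real-valued output. The local randomizer maps the input of one user to a random sequence of
messages, and the analyzer turns the shuffled sequence of all messages into the output.
The shuffler is always `shuffle`. -/
structure ShuffledProtocol (X M : Type*) where
  randomizer : X → PMF (List M)
  analyzer : List M → ℝ

namespace ShuffledProtocol

variable {X M : Type*}

/-- The output of the shuffler, which is the input of the analyzer: all the messages of all users,
randomly permuted. -/
def view (P : ShuffledProtocol X M) {n : ℕ} (x : Fin n → X) : PMF (List M) :=
  (concatOutputs P.randomizer (List.ofFn x)).bind shuffle

/-- Pure `ε`-differential privacy in the shuffled model, for `n` users: the output of the shuffler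
is `(ε, 0)`-DP. -/
def IsShuffledDP (P : ShuffledProtocol X M) (n : ℕ) (ε : ℝ) : Prop :=
  IsDP (fun x : Fin n → X => P.view x) ε 0

/-- Whatever the input, a user sends at most `m` messages. -/
def SendsAtMost (P : ShuffledProtocol X M) (m : ℕ) : Prop :=
  ∀ x : X, ∀ l ∈ (P.randomizer x).support, l.length ≤ m

/-- The expected absolute error of the protocol as an estimate of the real number `v`, when the
users hold the dataset `x`. -/
def expectedError (P : ShuffledProtocol X M) {n : ℕ} (x : Fin n → X) (v : ℝ) : ℝ≥0∞ :=
  ∑' y : List M, P.view x y * ENNReal.ofReal |P.analyzer y - v|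

end ShuffledProtocol

end

open scoped ENNReal

noncomputable section

/-! Each input is rounded to `L = Nat.clog 2 n` bits, and the bits of each significance are summed
by a separate protocol. Messages only carry a tag for the significance; the information is in how
many are sent. Since a shuffled list reveals only its multiset (`ShuffledProtocol.view_eq`), the
view is a convolution of independent user contributions, and privacy losses add over significances.

For one significance with noise parameter `s`, put `r = s ^ 2`. A user with bit `b` sends `D + b`
messages, except with the small probability `q = 200 * s / n`, when the number is drawn from a noise
law `g` of width about `r` that ignores `b`. About `200 * s` users are noisy, each causing error
`O(r)`, so the triangle inequality gives total error `O(s ^ 3)`, while the privacy loss is `4 / s ^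
2`. For a loss of order `ε` the error is therefore `O(ε ^ (-3/2))`.

Privacy is an inequality between coefficients of generating polynomials
(`nonnegPoly.sub_mem_of_edge`). If another user is noisy, shifting the total by one costs a factor
`exp (2 / r)`, except at the edge of the bounded support of `g`; the edge is paid for by the event
that two users are noisy. If no other user is noisy, the total is deterministic, and the probability
of this event is dominated by that of exactly four noisy users whose noise has the required sum
(`nonnegPoly.le_coeff_window_pow`).

Finally `exists_noise_levels` lets `s` grow geometrically with the significance index, up to a cap:
less significant bits get more noise, the losses sum to at most `ε`, and the weighted errors still
form a convergent geometric series. The resulting error `O(ε ^ (-3/2))` is slightly stronger than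
needed: the factor `√(log (2/ε))` is only used through its lower bound `1/2`. -/

/-! ### Convolution of discrete distributions -/

namespace PMF

variable {A B : Type*}

/-- The distributions on a commutative additive monoid form a commutative monoid under
convolution: the product is the law of the sum of independent samples. -/
instance convCommMonoid [AddCommMonoid A] : CommMonoid (PMF A) where
  mul p q := p.bind fun a => q.bind fun b => PMF.pure (a + b)
  one := PMF.pure 0
  mul_assoc p q r := by
    change PMF.bind (PMF.bind p _) _ = PMF.bind p fun a => PMF.bind (PMF.bind q _) _
    simp only [bind_bind, pure_bind, add_assoc]
  one_mul p := by
    change PMF.bind (PMF.pure 0) _ = p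
    simp [pure_bind]
  mul_one p := by
    change PMF.bind p (fun a => PMF.bind (PMF.pure 0) _) = p
    simp [pure_bind]
  mul_comm p q := by
    change PMF.bind p _ = PMF.bind q _
    rw [bind_comm]
    simp only [add_comm]

theorem mul_def [AddCommMonoid A] (p q : PMF A) :
    p * q = p.bind fun a => q.bind fun b => PMF.pure (a + b) := rfl

theorem one_def [AddCommMonoid A] : (1 : PMF A) = PMF.pure 0 := rfl

/-- Pushing forward along an additive homomorphism is multiplicative for convolution. -/
def mapHom [AddCommMonoid A] [AddCommMonoid B] (f : A →+ B) : PMF A →* PMF B where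
  toFun p := p.map f
  map_one' := by simp [one_def, pure_map]
  map_mul' p q := by
    simp only [mul_def, map_bind, bind_map, pure_map, map_add]
    rfl

theorem mapHom_apply [AddCommMonoid A] [AddCommMonoid B] (f : A →+ B) (p : PMF A) :
    mapHom f p = p.map f := rfl

/-! ### Pointwise domination -/

theorem bind_le_mul {p q : PMF A} {c : ℝ≥0∞} (h : ∀ a, p a ≤ c * q a) (f : A → PMF B) (b : B) :
    p.bind f b ≤ c * q.bind f b := by
  rw [bind_apply, bind_apply, ← ENNReal.tsum_mul_left]
  refine ENNReal.tsum_le_tsum fun a => ?_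
  rw [← mul_assoc]
  gcongr
  exact h a

theorem map_le_mul {p q : PMF A} {c : ℝ≥0∞} (h : ∀ a, p a ≤ c * q a) (f : A → B) (b : B) :
    p.map f b ≤ c * q.map f b :=
  bind_le_mul h _ b

theorem conv_le_mul [AddCommMonoid A] {p p' q q' : PMF A} {c d : ℝ≥0∞}
    (hp : ∀ a, p a ≤ c * p' a) (hq : ∀ a, q a ≤ d * q' a) (a : A) :
    (p * q) a ≤ c * d * (p' * q') a := by
  calc (p * q) a ≤ c * (p' * q) a := bind_le_mul hp _ a
    _ = c * (q * p') a := by rw [mul_comm p' q]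
    _ ≤ c * (d * (q' * p') a) := by gcongr; exact bind_le_mul hq _ a
    _ = c * d * (p' * q') a := by rw [mul_assoc, mul_comm q' p']

theorem prod_le_mul [AddCommMonoid A] {ι : Type*} (s : Finset ι) {p p' : ι → PMF A}
    {c : ι → ℝ≥0∞} (h : ∀ i ∈ s, ∀ a, p i a ≤ c i * p' i a) (a : A) :
    (∏ i ∈ s, p i) a ≤ (∏ i ∈ s, c i) * (∏ i ∈ s, p' i) a := by
  classical
  induction s using Finset.induction_on generalizing a with
  | empty => simp
  | insert i s his ih =>
    rw [Finset.prod_insert his, Finset.prod_insert his, Finset.prod_insert his]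
    exact conv_le_mul (h i (Finset.mem_insert_self i s))
      (ih fun j hj => h j (Finset.mem_insert_of_mem hj)) a

/-! ### Expectations of nonnegative functions -/

/-- The expectation of a nonnegative function. -/
def mean (p : PMF A) (h : A → ℝ≥0∞) : ℝ≥0∞ := ∑' a, p a * h a

theorem mean_mono (p : PMF A) {h k : A → ℝ≥0∞} (hk : ∀ a ∈ p.support, h a ≤ k a) :
    p.mean h ≤ p.mean k := by
  refine ENNReal.tsum_le_tsum fun a => ?_
  by_cases ha : a ∈ p.support
  · gcongr
    exact hk a ha
  · simp [(p.apply_eq_zero_iff a).2 ha]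

theorem mean_pure (a : A) (h : A → ℝ≥0∞) : (PMF.pure a).mean h = h a := by
  rw [mean, tsum_eq_single a]
  · simp
  · intro b hb
    simp [pure_apply, hb]

theorem mean_bind (p : PMF A) (f : A → PMF B) (h : B → ℝ≥0∞) :
    (p.bind f).mean h = p.mean fun a => (f a).mean h := by
  simp only [mean, bind_apply, ← ENNReal.tsum_mul_right, ← ENNReal.tsum_mul_left]
  rw [ENNReal.tsum_comm]
  simp only [mul_assoc]

theorem mean_map (p : PMF A) (f : A → B) (h : B → ℝ≥0∞) :
    (p.map f).mean h = p.mean fun a => h (f a) := by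
  rw [map, mean_bind]
  simp [mean_pure]

theorem mean_add (p : PMF A) (h k : A → ℝ≥0∞) :
    (p.mean fun a => h a + k a) = p.mean h + p.mean k := by
  simp only [mean, mul_add, ENNReal.tsum_add]

theorem mean_const (p : PMF A) (c : ℝ≥0∞) : (p.mean fun _ => c) = c := by
  rw [mean, ENNReal.tsum_mul_right, p.tsum_coe, one_mul]

theorem mean_mul_left (p : PMF A) (c : ℝ≥0∞) (h : A → ℝ≥0∞) :
    (p.mean fun a => c * h a) = c * p.mean h := by
  simp only [mean, ← ENNReal.tsum_mul_left, mul_left_comm]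

/-- The expected distance of an additive statistic of a sum of independent samples to a sum of
targets is at most the sum of the expected distances. -/
theorem mean_abs_prod_le [AddCommMonoid A] {ι : Type*} (s : Finset ι) (p : ι → PMF A)
    (φ : A →+ ℝ) (v : ι → ℝ) :
    (∏ i ∈ s, p i).mean (fun a => ENNReal.ofReal |φ a - ∑ i ∈ s, v i|)
      ≤ ∑ i ∈ s, (p i).mean fun a => ENNReal.ofReal |φ a - v i| := by
  classical
  induction s using Finset.induction_on with
  | empty => simp [one_def, mean_pure]
  | insert i s his ih =>
    rw [Finset.prod_insert his, Finset.sum_insert his, Finset.sum_insert his, mul_def, mean_bind]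
    refine le_trans ?_ (add_le_add_right ih _)
    rw [← mean_const (p i) ((∏ i ∈ s, p i).mean _), ← mean_add]
    refine mean_mono _ fun a _ => ?_
    rw [mean_bind]
    rw [← mean_const (∏ i ∈ s, p i) (ENNReal.ofReal |φ a - v i|), ← mean_add]
    refine mean_mono _ fun b _ => ?_
    rw [mean_pure, ← ENNReal.ofReal_add (abs_nonneg _) (abs_nonneg _), map_add,
      add_sub_add_comm]
    exact ENNReal.ofReal_le_ofReal (abs_add_le _ _)

theorem card_le_of_mem_support_prod {M ι : Type*} (s : Finset ι) (p : ι → PMF (Multiset M))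
    (d : ι → ℕ) (h : ∀ i ∈ s, ∀ a ∈ (p i).support, a.card ≤ d i) :
    ∀ a ∈ (∏ i ∈ s, p i).support, a.card ≤ ∑ i ∈ s, d i := by
  classical
  induction s using Finset.induction_on with
  | empty => simp [one_def]
  | insert i s his ih =>
    intro a ha
    rw [Finset.prod_insert his, mul_def] at ha
    simp only [mem_support_bind_iff, mem_support_pure_iff] at ha
    obtain ⟨b, hb, c, hc, rfl⟩ := ha
    rw [Finset.sum_insert his, Multiset.card_add]
    exact add_le_add (h i (Finset.mem_insert_self i s) b hb)
      (ih (fun j hj => h j (Finset.mem_insert_of_mem hj)) c hc)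

end PMF

/-! ### The view of the analyzer -/

/-- Every value has equally many positions in both lists, so the positions can be matched fibre by
fibre. -/
theorem exists_equiv_get_eq {M : Type*} {l l' : List M} (h : l.Perm l') :
    ∃ e : Fin l.length ≃ Fin l'.length, ∀ i, l'.get (e i) = l.get i := by
  classical
  have key : ∀ (k : List M) (a : M), Fintype.card {i // k.get i = a} = k.count a := by
    intro k a
    have h1 : (Multiset.map k.get Finset.univ.val).count a = k.count a := by
      rw [Fin.univ_val_map, List.ofFn_get, Multiset.coe_count]
    rw [← h1, Multiset.count_map, Fintype.card_subtype, Finset.card_def, Finset.filter_val]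
    simp only [eq_comm]
  have e : ∀ a : M, {i // l.get i = a} ≃ {i // l'.get i = a} := fun a =>
    Fintype.equivOfCardEq (by rw [key, key, h.count_eq])
  exact ⟨Equiv.ofFiberEquiv e, fun i => Equiv.ofFiberEquiv_map e i⟩

/-- The uniform law on permutations is invariant under left translation. -/
theorem map_ofFn_comp_equiv {M : Type*} {a b : ℕ} (e : Fin a ≃ Fin b) (f : Fin b → M) :
    ((PMF.uniformOfFintype (Equiv.Perm (Fin a))).map fun σ => List.ofFn fun i => f (e (σ i)))
      = (PMF.uniformOfFintype (Equiv.Perm (Fin b))).map fun σ => List.ofFn fun i => f (σ i) := by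
  have hab : a = b := by simpa using Fintype.card_congr e
  subst hab
  have hu : (PMF.uniformOfFintype (Equiv.Perm (Fin a))).map (Equiv.mulLeft e)
      = PMF.uniformOfFintype (Equiv.Perm (Fin a)) := by
    ext σ
    rw [PMF.map_apply, tsum_eq_single (e⁻¹ * σ)]
    · simp [PMF.uniformOfFintype_apply]
    · intro τ hτ
      rw [if_neg]
      rintro rfl
      simp at hτ
  conv_rhs => rw [← hu, PMF.map_comp]
  rfl

theorem shuffle_eq_of_perm {M : Type*} {l l' : List M} (h : l.Perm l') :
    shuffle l = shuffle l' := by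
  obtain ⟨e, he⟩ := exists_equiv_get_eq h
  unfold shuffle
  rw [← map_ofFn_comp_equiv e]
  simp only [he]

theorem map_coe_shuffle {M : Type*} (l : List M) :
    (shuffle l).map (fun k : List M => (k : Multiset M)) = PMF.pure (l : Multiset M) := by
  have h : ((fun k : List M => (k : Multiset M)) ∘ fun σ : Equiv.Perm (Fin l.length) =>
      List.ofFn fun i => l.get (σ i)) = Function.const _ (l : Multiset M) := by
    funext σ
    simp only [Function.comp, Function.const]
    refine Quot.sound ((σ.ofFn_comp_perm l.get).trans ?_)
    rw [List.ofFn_get]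
  rw [shuffle, PMF.map_comp, h, PMF.map_const]

/-- Passing to multisets turns concatenation into addition, hence independent runs into a
convolution product. -/
theorem map_coe_concatOutputs {X M : Type*} (R : X → PMF (List M)) (xs : List X) :
    (concatOutputs R xs).map (fun k : List M => (k : Multiset M))
      = (xs.map fun x => (R x).map fun k : List M => (k : Multiset M)).prod := by
  induction xs with
  | nil => simp [concatOutputs, PMF.one_def, PMF.pure_map]
  | cons x xs ih =>
    rw [List.map_cons, List.prod_cons, ← ih, concatOutputs, PMF.mul_def, PMF.map_bind,
      PMF.bind_map]
    congr 1
    funext a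
    simp only [Function.comp, PMF.map_comp, PMF.bind_map]
    rfl

namespace ShuffledProtocol

variable {X M : Type*}

/-- The multiset of messages is a sufficient statistic: shuffling does not depend on the order of
the list, so the list may be replaced by any enumeration of its multiset. -/
theorem view_eq (P : ShuffledProtocol X M) {n : ℕ} (x : Fin n → X) :
    P.view x = (∏ i, (P.randomizer (x i)).map fun k : List M => (k : Multiset M)).bind
      fun s => shuffle s.toList := by
  have h := map_coe_concatOutputs P.randomizer (List.ofFn x)
  rw [List.map_ofFn, List.prod_ofFn] at h
  simp only [Function.comp] at h
  rw [← h, PMF.bind_map, view]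
  congr 1
  funext l
  exact shuffle_eq_of_perm (Quotient.exact (Multiset.coe_toList _)).symm

/-- A protocol is private if the multiset of all messages is. -/
theorem isShuffledDP_of_multiset (P : ShuffledProtocol X M) (n : ℕ) (ε : ℝ)
    (h : ∀ x x' : Fin n → X, (∃ i, ∀ j, j ≠ i → x j = x' j) → ∀ s : Multiset M,
      (∏ i, (P.randomizer (x i)).map fun k : List M => (k : Multiset M)) s
        ≤ ENNReal.ofReal (Real.exp ε) *
          (∏ i, (P.randomizer (x' i)).map fun k : List M => (k : Multiset M)) s) :
    P.IsShuffledDP n ε := by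
  intro x x' hx S
  simp only [view_eq, PMF.toOuterMeasure_bind_apply, ENNReal.ofReal_zero, add_zero]
  rw [← ENNReal.tsum_mul_left]
  refine ENNReal.tsum_le_tsum fun s => ?_
  rw [← mul_assoc]
  gcongr
  exact h x x' hx s

theorem expectedError_eq (P : ShuffledProtocol X M) {n : ℕ} (x : Fin n → X) (v : ℝ)
    (a : Multiset M → ℝ) (ha : ∀ l : List M, P.analyzer l = a l) :
    P.expectedError x v
      = (∏ i, (P.randomizer (x i)).map fun k : List M => (k : Multiset M)).mean
        fun s => ENNReal.ofReal |a s - v| := by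
  have h : P.expectedError x v
      = ((P.view x).map fun k : List M => (k : Multiset M)).mean
        fun s => ENNReal.ofReal |a s - v| := by
    rw [PMF.mean_map]
    simp only [expectedError, PMF.mean, ha]
  rw [h, view_eq, PMF.map_bind]
  simp only [map_coe_shuffle, Multiset.coe_toList, PMF.bind_pure]

end ShuffledProtocol

/-! ### Generating polynomials and coefficientwise domination. -/

open Polynomial in
/-- The real polynomials with nonnegative coefficients. -/
def nonnegPoly : Subsemiring ℝ[X] where
  carrier := {p | ∀ k, 0 ≤ p.coeff k}
  mul_mem' := by
    intro p q hp hq k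
    rw [coeff_mul]
    exact Finset.sum_nonneg fun x _ => mul_nonneg (hp _) (hq _)
  one_mem' := by
    intro k
    rw [coeff_one]
    split_ifs <;> norm_num
  add_mem' := by
    intro p q hp hq k
    rw [coeff_add]
    exact add_nonneg (hp k) (hq k)
  zero_mem' := by
    intro k
    simp

namespace nonnegPoly

open Polynomial

theorem C_mem {a : ℝ} (ha : 0 ≤ a) : (C a : ℝ[X]) ∈ nonnegPoly := by
  intro k
  rw [coeff_C]
  split_ifs <;> simp [ha]

theorem X_pow_mem (n : ℕ) : (X ^ n : ℝ[X]) ∈ nonnegPoly := by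
  intro k
  rw [coeff_X_pow]
  split_ifs <;> norm_num

/-- Write each `p i` as `q i + (p i - q i)`: every term of the expanded product has nonnegative
coefficients, and one of them is `∏ q i`. -/
theorem prod_sub_prod_mem {ι : Type*} (s : Finset ι) {p q : ι → ℝ[X]}
    (hpq : ∀ i ∈ s, p i - q i ∈ nonnegPoly) (hq : ∀ i ∈ s, q i ∈ nonnegPoly) :
    ∏ i ∈ s, p i - ∏ i ∈ s, q i ∈ nonnegPoly := by
  classical
  induction s using Finset.induction_on with
  | empty => simp
  | insert i s his ih =>
    have h1 := ih (fun j hj => hpq j (Finset.mem_insert_of_mem hj))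
      fun j hj => hq j (Finset.mem_insert_of_mem hj)
    have h2 : ∏ j ∈ s, q j ∈ nonnegPoly :=
      Subsemiring.prod_mem _ fun j hj => hq j (Finset.mem_insert_of_mem hj)
    have h3 := hpq i (Finset.mem_insert_self i s)
    have h4 := hq i (Finset.mem_insert_self i s)
    rw [Finset.prod_insert his, Finset.prod_insert his]
    have : p i * ∏ j ∈ s, p j - q i * ∏ j ∈ s, q j
        = (p i - q i) * (∏ j ∈ s, p j - ∏ j ∈ s, q j) + (p i - q i) * ∏ j ∈ s, q j
          + q i * (∏ j ∈ s, p j - ∏ j ∈ s, q j) := by ring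
    rw [this]
    exact add_mem (add_mem (mul_mem h3 h1) (mul_mem h3 h2)) (mul_mem h4 h1)

/-- The square of a polynomial whose coefficients near `m` are large has large coefficients
near `2 * m`. -/
theorem le_coeff_mul_self {p : ℝ[X]} (hp : p ∈ nonnegPoly) {m r : ℕ} {α : ℝ} (hα : 0 ≤ α)
    (hr : r ≤ m) (h : ∀ k, m ≤ k + r → k ≤ m + r → α ≤ p.coeff k) (k : ℕ)
    (hk : 2 * m ≤ k + r) (hk' : k ≤ 2 * m + r) : r * α ^ 2 ≤ (p * p).coeff k := by
  rw [coeff_mul, Finset.Nat.sum_antidiagonal_eq_sum_range_succ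
    (fun i j => p.coeff i * p.coeff j)]
  -- These are `r` consecutive indices `i` for which both `i` and `k - i` lie within `r` of `m`;
  -- they start at `m` or end just below it, according to the side of `2 * m` on which `k` lies.
  obtain ⟨lo, hlo⟩ : ∃ lo, lo + r ≤ k + 1 ∧ ∀ i, lo ≤ i → i < lo + r →
      (m ≤ i + r ∧ i ≤ m + r) ∧ (m ≤ k - i + r ∧ k - i ≤ m + r) := by
    rcases le_total (2 * m) k with hc | hc
    · exact ⟨m, by omega, fun i h1 h2 => by omega⟩
    · exact ⟨m - r, by omega, fun i h1 h2 => by omega⟩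
  have hsub : Finset.Ico lo (lo + r) ⊆ Finset.range (k + 1) := by
    intro i hi
    simp only [Finset.mem_Ico, Finset.mem_range] at hi ⊢
    omega
  calc r * α ^ 2 = ∑ i ∈ Finset.Ico lo (lo + r), α ^ 2 := by simp
    _ ≤ ∑ i ∈ Finset.Ico lo (lo + r), p.coeff i * p.coeff (k - i) := by
      refine Finset.sum_le_sum fun i hi => ?_
      rw [Finset.mem_Ico] at hi
      obtain ⟨h1, h2⟩ := hlo.2 i hi.1 hi.2
      rw [sq]
      exact mul_le_mul (h i h1.1 h1.2) (h _ h2.1 h2.2) hα (hp i)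
    _ ≤ _ := Finset.sum_le_sum_of_subset_of_nonneg hsub fun i _ _ => mul_nonneg (hp _) (hp _)

/-- A lower bound for the probability that exactly four of `N` users are noisy and that their
noise, uniform in a window of radius `r`, has a prescribed small sum. -/
theorem le_coeff_window_pow {N r : ℕ} (hN : 4 ≤ N) {q a : ℝ} (hq : 0 ≤ q) (hq1 : q ≤ 1)
    (ha : 0 ≤ a) (k : ℕ) (hk : r * N ≤ k + r) (hk' : k ≤ r * N + r) :
    (N.choose 4 : ℝ) * (1 - q) ^ (N - 4) * (q * a) ^ 4 * r ^ 3
      ≤ ((C (1 - q) * X ^ r + C (q * a) * ∑ i ∈ Finset.range (2 * r + 1), X ^ i) ^ N :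
          ℝ[X]).coeff k := by
  set T : ℝ[X] := ∑ i ∈ Finset.range (2 * r + 1), X ^ i with hT
  have hTmem : T ∈ nonnegPoly := Subsemiring.sum_mem _ fun i _ => X_pow_mem i
  have hTc : ∀ j, r ≤ j + r → j ≤ r + r → (1 : ℝ) ≤ T.coeff j := by
    intro j _ hj
    rw [hT, finsetSum_coeff]
    simp only [coeff_X_pow]
    rw [Finset.sum_ite_eq, if_pos (Finset.mem_range.2 (by omega))]
  -- Squaring twice: the coefficients of `T` near `r` are at least `1`, those of `T ^ 2` near `2 *
  -- r` at least `r`, those of `T ^ 4` near `4 * r` at least `r ^ 3`.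
  have hT2 := le_coeff_mul_self hTmem zero_le_one le_rfl hTc
  have hT4 := le_coeff_mul_self (mul_mem hTmem hTmem) (m := 2 * r) (r := r)
    (α := r * 1 ^ 2) (by positivity) (by omega) hT2
  obtain ⟨j, rfl⟩ : ∃ j, k = j + r * (N - 4) := by
    refine ⟨k - r * (N - 4), ?_⟩
    have : r * N = r * (N - 4) + 4 * r := by
      conv_lhs => rw [← Nat.sub_add_cancel hN]
      ring
    omega
  have hrN : r * N = r * (N - 4) + 4 * r := by
    conv_lhs => rw [← Nat.sub_add_cancel hN]
    ring
  have hmem : ∀ m ∈ Finset.range (N + 1), (C (1 - q) * X ^ r) ^ m * (C (q * a) * T) ^ (N - m)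
      * (N.choose m : ℝ[X]) ∈ nonnegPoly := by
    intro m _
    refine mul_mem (mul_mem (pow_mem (mul_mem (C_mem (by linarith)) (X_pow_mem r)) _)
      (pow_mem (mul_mem (C_mem (by positivity)) hTmem) _)) ?_
    exact natCast_mem _ _
  -- Only the binomial term with exactly four noisy factors is kept.
  rw [add_pow, finsetSum_coeff]
  refine le_trans ?_ (Finset.single_le_sum (fun m hm => hmem m hm _)
    (Finset.mem_range.2 (show N - 4 < N + 1 by omega)))
  have h4 : N - (N - 4) = 4 := by omega
  have hform : (C (1 - q) * X ^ r) ^ (N - 4) * (C (q * a) * T) ^ (N - (N - 4))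
      * (N.choose (N - 4) : ℝ[X])
      = C ((N.choose 4 : ℝ) * (1 - q) ^ (N - 4) * (q * a) ^ 4) *
        ((T * T * (T * T)) * X ^ (r * (N - 4))) := by
    rw [h4, Nat.choose_symm hN]
    simp only [C_mul, C_pow, map_natCast]
    ring
  rw [hform, coeff_C_mul, coeff_mul_X_pow]
  have := hT4 j (by omega) (by omega)
  have hc : (0 : ℝ) ≤ (N.choose 4 : ℝ) * (1 - q) ^ (N - 4) * (q * a) ^ 4 := by
    have : 0 ≤ 1 - q := by linarith
    positivity
  calc _ ≤ (N.choose 4 : ℝ) * (1 - q) ^ (N - 4) * (q * a) ^ 4 * (r * (r * 1 ^ 2) ^ 2) := by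
        apply le_of_eq; ring
    _ ≤ _ := mul_le_mul_of_nonneg_left this hc

/-- In the sum of the outputs of several users, either nobody is noisy or somebody is. -/
theorem exists_prod_eq {ι : Type*} (s : Finset ι) (D : ℕ) (b : ι → ℕ) {q : ℝ} (hq : 0 ≤ q)
    (hq1 : q ≤ 1) {g : ℝ[X]} (hg : g ∈ nonnegPoly) :
    ∃ H ∈ nonnegPoly, ∏ i ∈ s, (C (1 - q) * X ^ (D + b i) + C q * g)
      = C ((1 - q) ^ s.card) * X ^ (∑ i ∈ s, (D + b i)) + g * H := by
  classical
  have hq1' : 0 ≤ 1 - q := by linarith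
  induction s using Finset.induction_on with
  | empty => exact ⟨0, zero_mem _, by simp⟩
  | insert i s his ih =>
    obtain ⟨H, hH, h⟩ := ih
    refine ⟨C q * (C ((1 - q) ^ s.card) * X ^ (∑ i ∈ s, (D + b i)))
      + (C (1 - q) * X ^ (D + b i) + C q * g) * H, ?_, ?_⟩
    · exact add_mem (mul_mem (C_mem hq) (mul_mem (C_mem (by positivity)) (X_pow_mem _)))
        (mul_mem (add_mem (mul_mem (C_mem hq1') (X_pow_mem _)) (mul_mem (C_mem hq) hg)) hH)
    · rw [Finset.prod_insert his, Finset.sum_insert his, Finset.card_insert_of_notMem his, h,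
        pow_succ, C_mul, pow_add _ (D + b i)]
      ring

/-- The privacy argument, in terms of generating polynomials: `U` and `V` are the noiseless
outputs for the two inputs of one user, `g` is the noise, and `F` is the contribution of all the
other users, with part `W` where nobody is noisy. -/
theorem sub_mem_of_edge {U V g F W H B : ℝ[X]} {q c c' e β : ℝ} (hq1 : q ≤ 1)
    (hc' : 0 ≤ c') (hβ : 0 ≤ β) (he : c + c' = e) (hβq : (1 - q) * β ≤ (e - 1) * q)
    (hg : g ∈ nonnegPoly) (hF : F ∈ nonnegPoly) (hH : H ∈ nonnegPoly) (hW : W ∈ nonnegPoly)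
    (hFW : F = W + g * H) (hV : V ∈ nonnegPoly)
    (hedge : C c' * V * g + B - U * g ∈ nonnegPoly)
    (hB : C β * (g * g) - B ∈ nonnegPoly)
    (hUW : C c * V * F - U * W ∈ nonnegPoly) :
    C e * ((C (1 - q) * V + C q * g) * F) - (C (1 - q) * U + C q * g) * F ∈ nonnegPoly := by
  have key : C e * ((C (1 - q) * V + C q * g) * F) - (C (1 - q) * U + C q * g) * F
      = C (1 - q) * ((C c * V * F - U * W) + (C c' * V * g + B - U * g) * H
          + (C β * (g * g) - B) * H + C c' * V * W + C β * g * W)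
        + C ((e - 1) * q - (1 - q) * β) * (g * F) := by
    subst he
    simp only [C_sub, C_mul, C_add, C_1, hFW]
    ring
  rw [key]
  have h1 := C_mem hc'
  have h2 := C_mem hβ
  exact add_mem (mul_mem (C_mem (by linarith)) (add_mem (add_mem (add_mem (add_mem hUW
    (mul_mem hedge hH)) (mul_mem hB hH)) (mul_mem (mul_mem h1 hV) hW))
    (mul_mem (mul_mem h2 hg) hW))) (mul_mem (C_mem (by linarith)) (mul_mem hg hF))

/-- The distribution with a given generating polynomial. -/
def law (p : ℝ[X]) (hp : p ∈ nonnegPoly) (h1 : p.eval 1 = 1) : PMF ℕ :=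
  PMF.ofFinset (fun k => ENNReal.ofReal (p.coeff k)) p.support
    (by
      rw [← ENNReal.ofReal_sum_of_nonneg fun k _ => hp k]
      rw [eval_eq_sum, Polynomial.sum] at h1
      simp only [one_pow, mul_one] at h1
      rw [h1, ENNReal.ofReal_one])
    (by
      intro k hk
      simp [notMem_support_iff.1 hk])

theorem law_apply (p : ℝ[X]) (hp : p ∈ nonnegPoly) (h1 : p.eval 1 = 1) (k : ℕ) :
    law p hp h1 k = ENNReal.ofReal (p.coeff k) := rfl

/-- The generating polynomial of a sum of independent variables is the product of the generating
polynomials. -/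
theorem conv_apply {P Q : PMF ℕ} {p q : ℝ[X]} (hp : p ∈ nonnegPoly) (hq : q ∈ nonnegPoly)
    (hP : ∀ k, P k = ENNReal.ofReal (p.coeff k)) (hQ : ∀ k, Q k = ENNReal.ofReal (q.coeff k))
    (k : ℕ) : (P * Q) k = ENNReal.ofReal ((p * q).coeff k) := by
  rw [PMF.mul_def, PMF.bind_apply, coeff_mul, Finset.Nat.sum_antidiagonal_eq_sum_range_succ
    (fun i j => p.coeff i * q.coeff j), ENNReal.ofReal_sum_of_nonneg
    fun i _ => mul_nonneg (hp _) (hq _), tsum_eq_sum (s := Finset.range (k + 1))]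
  · refine Finset.sum_congr rfl fun i hi => ?_
    rw [Finset.mem_range] at hi
    rw [ENNReal.ofReal_mul (hp i), ← hP, ← hQ, PMF.bind_apply, tsum_eq_single (k - i)]
    · rw [PMF.pure_apply, if_pos (by omega), mul_one]
    · intro j hj
      rw [PMF.pure_apply, if_neg (by omega), mul_zero]
  · intro i hi
    rw [Finset.mem_range] at hi
    rw [PMF.bind_apply]
    have : ∀ j, Q j * (PMF.pure (i + j)) k = 0 := by
      intro j
      rw [PMF.pure_apply, if_neg (by omega), mul_zero]
    simp only [this, tsum_zero, mul_zero]

theorem conv_prod_apply {ι : Type*} (s : Finset ι) {P : ι → PMF ℕ} {p : ι → ℝ[X]}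
    (hp : ∀ i, p i ∈ nonnegPoly) (hP : ∀ i k, P i k = ENNReal.ofReal ((p i).coeff k)) (k : ℕ) :
    (∏ i ∈ s, P i) k = ENNReal.ofReal ((∏ i ∈ s, p i).coeff k) := by
  classical
  induction s using Finset.induction_on generalizing k with
  | empty =>
    rw [Finset.prod_empty, Finset.prod_empty, PMF.one_def, PMF.pure_apply, coeff_one]
    split_ifs <;> simp
  | insert i s his ih =>
    rw [Finset.prod_insert his, Finset.prod_insert his]
    exact conv_apply (hp i) (Subsemiring.prod_mem _ fun j _ => hp j) (hP i) ih k

end nonnegPoly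

/-! ### Privacy of the summation of bits -/

namespace nonnegPoly

open Polynomial

theorem sub_C_mul_X_pow_mem {P : ℝ[X]} (hP : P ∈ nonnegPoly) {a : ℝ} {t : ℕ}
    (h : a ≤ P.coeff t) : P - C a * X ^ t ∈ nonnegPoly := by
  intro k
  rw [coeff_sub, coeff_C_mul_X_pow]
  split_ifs with hk
  · subst hk; linarith
  · simpa using hP k

theorem four_pow_choose_bound {n : ℕ} (hn : 8 ≤ n) : (n : ℝ) ^ 4 ≤ 384 * ((n - 1).choose 4 : ℝ) := by
  have h1 := Nat.pow_sub_le_descFactorial (n - 1) 4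
  rw [Nat.descFactorial_eq_factorial_mul_choose] at h1
  have h2 : n ≤ 2 * (n - 1 + 1 - 4) := by omega
  have h3 : n ^ 4 ≤ 384 * (n - 1).choose 4 := by
    calc n ^ 4 ≤ (2 * (n - 1 + 1 - 4)) ^ 4 := Nat.pow_le_pow_left h2 4
      _ = 16 * (n - 1 + 1 - 4) ^ 4 := by ring
      _ ≤ 16 * (Nat.factorial 4 * (n - 1).choose 4) := by gcongr
      _ = 384 * (n - 1).choose 4 := by norm_num [Nat.factorial]; ring
  exact_mod_cast h3

/-- The generating polynomial of the number of messages sent by a user with bit `b`: with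
probability `1 - q` it is `D + b`, otherwise it is drawn from the noise `g`. -/
def bitPoly (D : ℕ) (q : ℝ) (g : ℝ[X]) (b : ℕ) : ℝ[X] := C (1 - q) * X ^ (D + b) + C q * g

theorem bitPoly_mem {D : ℕ} {q : ℝ} {g : ℝ[X]} (hq : 0 ≤ q) (hq1 : q ≤ 1)
    (hg : g ∈ nonnegPoly) (b : ℕ) : bitPoly D q g b ∈ nonnegPoly :=
  add_mem (mul_mem (C_mem (by linarith)) (X_pow_mem _)) (mul_mem (C_mem hq) hg)

/-- The properties of the noise that give privacy. -/
structure IsBitNoise (D r : ℕ) (q a g₀ : ℝ) (g : ℝ[X]) : Prop where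
  mem : g ∈ nonnegPoly
  le_succ : ∀ k < 2 * D, g.coeff k ≤ Real.exp (2 / r) * g.coeff (k + 1)
  succ_le : ∀ k < 2 * D, g.coeff (k + 1) ≤ Real.exp (2 / r) * g.coeff k
  coeff_zero : g.coeff 0 = g₀
  coeff_last : g.coeff (2 * D) = g₀
  coeff_of_lt : ∀ k, 2 * D < k → g.coeff k = 0
  sq_left : g₀ ≤ 4 * q / r * (g * g).coeff D
  sq_right : g₀ ≤ 4 * q / r * (g * g).coeff (3 * D + 1)
  window : ∀ k, D ≤ k + r → k ≤ D + r + 1 → a ≤ g.coeff k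

/-- Around its centre `g` dominates `a` times a flat window of radius `r`. The extra unit in
`window` lets this window be shifted along with the bit, so each factor dominates a shift of one
fixed polynomial and `le_coeff_window_pow` applies. -/
theorem IsBitNoise.le_coeff_prod {D r : ℕ} {q a g₀ : ℝ} {g : ℝ[X]} (h : IsBitNoise D r q a g₀ g)
    (hq : 0 ≤ q) (hq1 : q ≤ 1) (ha : 0 ≤ a) (hr : 1 ≤ r) (hrD : r ≤ D)
    {ι : Type*} (s : Finset ι) (hs : 4 ≤ s.card) (b : ι → ℕ) (hb : ∀ i, b i ≤ 1) (k : ℕ)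
    (hk : ∑ i ∈ s, (D + b i) ≤ k + 1) (hk' : k ≤ ∑ i ∈ s, (D + b i) + 1) :
    (s.card.choose 4 : ℝ) * (1 - q) ^ (s.card - 4) * (q * a) ^ 4 * r ^ 3
      ≤ (∏ i ∈ s, bitPoly D q g (b i)).coeff k := by
  set u : ℝ[X] := C (1 - q) * X ^ r + C (q * a) * ∑ i ∈ Finset.range (2 * r + 1), X ^ i with hu
  have hT : (∑ i ∈ Finset.range (2 * r + 1), X ^ i : ℝ[X]) ∈ nonnegPoly :=
    Subsemiring.sum_mem _ fun i _ => X_pow_mem i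
  have hum : u ∈ nonnegPoly :=
    add_mem (mul_mem (C_mem (by linarith)) (X_pow_mem _)) (mul_mem (C_mem (by positivity)) hT)
  have hsub : ∀ i ∈ s, bitPoly D q g (b i) - X ^ (D - r + b i) * u ∈ nonnegPoly := by
    intro i _
    have hbi := hb i
    have h1 : bitPoly D q g (b i) - X ^ (D - r + b i) * u
        = C q * (g - C a * (X ^ (D - r + b i) * ∑ i ∈ Finset.range (2 * r + 1), X ^ i)) := by
      rw [bitPoly, hu, show D + b i = (D - r + b i) + r by omega, pow_add _ _ r, C_mul]
      ring
    rw [h1]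
    refine mul_mem (C_mem hq) fun k => ?_
    rw [coeff_sub, coeff_C_mul, coeff_X_pow_mul', finsetSum_coeff]
    simp only [coeff_X_pow, Finset.sum_ite_eq, Finset.mem_range]
    have := h.mem k
    split_ifs with h1 h2
    · have := h.window k (by omega) (by omega)
      linarith
    · linarith
    · linarith
  have hprod := prod_sub_prod_mem s hsub fun i _ => mul_mem (X_pow_mem _) hum
  have hk1 := hprod k
  rw [coeff_sub] at hk1
  refine le_trans ?_ (sub_nonneg.1 hk1)
  rw [Finset.prod_mul_distrib, Finset.prod_pow_eq_pow_sum, Finset.prod_const]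
  have hsum : ∑ i ∈ s, (D + b i) = ∑ i ∈ s, (D - r + b i) + r * s.card := by
    rw [mul_comm, ← smul_eq_mul, ← Finset.sum_const, ← Finset.sum_add_distrib]
    exact Finset.sum_congr rfl fun i _ => by omega
  have hc : r * 4 ≤ r * s.card := Nat.mul_le_mul_left r hs
  obtain ⟨j, rfl⟩ : ∃ j, k = j + ∑ i ∈ s, (D - r + b i) :=
    ⟨k - ∑ i ∈ s, (D - r + b i), by omega⟩
  rw [coeff_X_pow_mul]
  exact le_coeff_window_pow hs hq hq1 ha j (by omega) (by omega)

theorem exp_four_sub_exp_two {r : ℕ} (hr : 1 ≤ r) :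
    2 / (r : ℝ) ≤ Real.exp (4 / r) - Real.exp (2 / r) := by
  have hr' : (0 : ℝ) < r := by exact_mod_cast hr
  have h1 : Real.exp (4 / r) = Real.exp (2 / r) * Real.exp (2 / r) := by
    rw [← Real.exp_add]; congr 1; ring
  have h2 := Real.add_one_le_exp (2 / (r : ℝ))
  have h3 : 0 < 2 / (r : ℝ) := by positivity
  rw [h1]
  nlinarith

/-- Changing the bit of one user changes the probabilities of the total number of messages by a
factor of at most `exp (4 / r)`. -/
theorem IsBitNoise.private {D r n : ℕ} {q a g₀ : ℝ} {g : ℝ[X]} (h : IsBitNoise D r q a g₀ g)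
    (hq : 0 ≤ q) (hq1 : q ≤ 1) (ha : 0 ≤ a) (hr : 1 ≤ r) (hrD : r ≤ D) (hn : 8 ≤ n)
    (hqa : 384 ≤ 2 * r ^ 2 * (n * (q * a)) ^ 4)
    {ι : Type*} (s : Finset ι) (hs : s.card = n - 1) (b : ι → ℕ) (hb : ∀ i, b i ≤ 1)
    (β β' : ℕ) (hβ : β ≤ 1) (hβ' : β' ≤ 1) (k : ℕ) :
    (bitPoly D q g β * ∏ i ∈ s, bitPoly D q g (b i)).coeff k
      ≤ Real.exp (4 / r) * (bitPoly D q g β' * ∏ i ∈ s, bitPoly D q g (b i)).coeff k := by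
  have hr' : (0 : ℝ) < r := by exact_mod_cast hr
  have hq1' : 0 ≤ 1 - q := by linarith
  set F := ∏ i ∈ s, bitPoly D q g (b i) with hFdef
  have hF : F ∈ nonnegPoly := Subsemiring.prod_mem _ fun i _ => bitPoly_mem hq hq1 h.mem _
  rcases eq_or_ne β β' with rfl | hne
  · have : 0 ≤ (bitPoly D q g β * F).coeff k := mul_mem (bitPoly_mem hq hq1 h.mem β) hF k
    exact le_mul_of_one_le_left this (Real.one_le_exp (by positivity))
  obtain ⟨H, hH, hFH⟩ := exists_prod_eq s D b hq hq1 h.mem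
  set m := ∑ i ∈ s, (D + b i) with hm
  have hm1 : 1 ≤ m := by
    have : 1 * s.card ≤ m := by
      rw [hm, mul_comm, ← smul_eq_mul, ← Finset.sum_const]
      exact Finset.sum_le_sum fun i _ => by omega
    omega
  have hcc := exp_four_sub_exp_two hr
  set c := Real.exp (4 / r) - Real.exp (2 / r) with hc
  have hc0 : 0 ≤ c := le_trans (by positivity) hcc
  have hg0 : 0 ≤ g₀ := h.coeff_zero ▸ h.mem 0
  -- the probability that nobody is noisy is small compared to nearby totals
  have hquiet : ∀ j, m ≤ j + 1 → j ≤ m + 1 → (1 - q) ^ s.card ≤ c * F.coeff j := by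
    intro j hj hj'
    have h1 := h.le_coeff_prod hq hq1 ha hr hrD s (by omega) b hb j hj hj'
    have h2 := four_pow_choose_bound hn
    rw [← hs] at h2
    have h3 : (1 - q) ^ s.card ≤ (1 - q) ^ (s.card - 4) :=
      pow_le_pow_of_le_one hq1' (by linarith) (Nat.sub_le _ _)
    have h4 : 1 ≤ 2 / (r : ℝ) * ((s.card.choose 4 : ℝ) * (q * a) ^ 4 * r ^ 3) := by
      have h5 : 2 / (r : ℝ) * ((s.card.choose 4 : ℝ) * (q * a) ^ 4 * r ^ 3)
          = 2 * r ^ 2 * (q * a) ^ 4 * s.card.choose 4 := by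
        field_simp
      rw [h5]
      rw [mul_pow] at hqa
      have : 384 ≤ 2 * (r : ℝ) ^ 2 * (q * a) ^ 4 * (384 * s.card.choose 4) :=
        calc (384 : ℝ) ≤ 2 * r ^ 2 * (n ^ 4 * (q * a) ^ 4) := hqa
          _ = 2 * r ^ 2 * (q * a) ^ 4 * n ^ 4 := by ring
          _ ≤ _ := by gcongr
      linarith
    have h5 : 0 ≤ (1 - q) ^ (s.card - 4) := by positivity
    calc (1 - q) ^ s.card ≤ (1 - q) ^ (s.card - 4) * 1 := by linarith
      _ ≤ (1 - q) ^ (s.card - 4) * (2 / (r : ℝ) * ((s.card.choose 4 : ℝ) * (q * a) ^ 4 * r ^ 3)) :=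
        by gcongr
      _ = 2 / r * ((s.card.choose 4 : ℝ) * (1 - q) ^ (s.card - 4) * (q * a) ^ 4 * r ^ 3) := by ring
      _ ≤ c * F.coeff j := by gcongr
  have hexp4 : 4 / (r : ℝ) ≤ Real.exp (4 / r) - 1 := by
    linarith [Real.add_one_le_exp (4 / (r : ℝ))]
  have hβq : (1 - q) * (4 * q / r) ≤ (Real.exp (4 / r) - 1) * q := by
    calc (1 - q) * (4 * q / r) ≤ 1 * (4 * q / r) := by gcongr; linarith
      _ = 4 / r * q := by ring
      _ ≤ _ := by gcongr
  have hW : C ((1 - q) ^ s.card) * X ^ m ∈ nonnegPoly :=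
    mul_mem (C_mem (by positivity)) (X_pow_mem _)
  have hexp0 : 0 ≤ Real.exp (2 / (r : ℝ)) := (Real.exp_pos _).le
  have hgg : C (4 * q / r) * (g * g) ∈ nonnegPoly :=
    mul_mem (C_mem (by positivity)) (mul_mem h.mem h.mem)
  have main : C (Real.exp (4 / r)) * ((C (1 - q) * X ^ (D + β') + C q * g) * F)
      - (C (1 - q) * X ^ (D + β) + C q * g) * F ∈ nonnegPoly := by
    have hcases : (β = 0 ∧ β' = 1) ∨ (β = 1 ∧ β' = 0) := by omega
    rcases hcases with ⟨rfl, rfl⟩ | ⟨rfl, rfl⟩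
    -- The bit rises from 0 to 1: `X ^ D * g` charges the total `D`, which lies just below the
    -- support of `X ^ (D + 1) * g`. This bottom edge is `B`.
    · refine sub_mem_of_edge (c := c) (c' := Real.exp (2 / r)) (β := 4 * q / r)
        (B := C g₀ * X ^ D) hq1 hexp0 (by positivity) (by rw [hc]; ring) hβq h.mem hF hH hW hFH
        (X_pow_mem _) ?_ ?_ ?_
      · have : C (Real.exp (2 / r)) * X ^ (D + 1) * g + C g₀ * X ^ D - X ^ (D + 0) * g
            = X ^ D * (C (Real.exp (2 / r)) * (X * g) + C g₀ - g) := by ring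
        rw [this]
        refine mul_mem (X_pow_mem _) fun j => ?_
        rw [coeff_sub, coeff_add, coeff_C_mul]
        rcases j with _ | j
        · simp [h.coeff_zero]
        · rw [coeff_X_mul, coeff_C_succ]
          rcases lt_or_ge j (2 * D) with hj | hj
          · linarith [h.succ_le j hj]
          · rw [h.coeff_of_lt (j + 1) (by omega)]
            have := mul_nonneg hexp0 (h.mem j)
            linarith
      · refine sub_C_mul_X_pow_mem hgg ?_
        rw [coeff_C_mul]
        exact h.sq_left
      · have : X ^ (D + 0) * (C ((1 - q) ^ s.card) * X ^ m)
            = C ((1 - q) ^ s.card) * X ^ (m - 1 + (D + 1)) := by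
          rw [show m - 1 + (D + 1) = D + 0 + m by omega, pow_add _ (D + 0)]
          ring
        rw [this]
        refine sub_C_mul_X_pow_mem
          (mul_mem (mul_mem (C_mem hc0) (X_pow_mem _)) hF) ?_
        rw [mul_assoc, coeff_C_mul, coeff_X_pow_mul]
        exact hquiet _ (by omega) (by omega)
    -- The bit falls from 1 to 0: now the uncovered total is the top one, `(D + 1) + 2 * D`.
    · refine sub_mem_of_edge (c := c) (c' := Real.exp (2 / r)) (β := 4 * q / r)
        (B := C g₀ * X ^ (3 * D + 1)) hq1 hexp0 (by positivity) (by rw [hc]; ring) hβq h.mem hF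
        hH hW hFH (X_pow_mem _) ?_ ?_ ?_
      · have : C (Real.exp (2 / r)) * X ^ (D + 0) * g + C g₀ * X ^ (3 * D + 1) - X ^ (D + 1) * g
            = X ^ D * (C (Real.exp (2 / r)) * g + C g₀ * X ^ (2 * D + 1) - X * g) := by ring
        rw [this]
        refine mul_mem (X_pow_mem _) fun j => ?_
        rw [coeff_sub, coeff_add, coeff_C_mul, coeff_C_mul_X_pow]
        have h1 := mul_nonneg hexp0 (h.mem j)
        rcases j with _ | j
        · simpa using h1
        · rw [coeff_X_mul]
          rcases lt_trichotomy j (2 * D) with hj | hj | hj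
          · rw [if_neg (by omega)]
            linarith [h.le_succ j hj]
          · rw [if_pos (by omega), hj, h.coeff_last]
            rw [hj] at h1
            linarith
          · rw [h.coeff_of_lt j hj, if_neg (by omega)]
            linarith
      · refine sub_C_mul_X_pow_mem hgg ?_
        rw [coeff_C_mul]
        exact h.sq_right
      · have : X ^ (D + 1) * (C ((1 - q) ^ s.card) * X ^ m)
            = C ((1 - q) ^ s.card) * X ^ (m + 1 + (D + 0)) := by
          rw [show m + 1 + (D + 0) = D + 1 + m by omega, pow_add _ (D + 1)]
          ring
        rw [this]
        refine sub_C_mul_X_pow_mem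
          (mul_mem (mul_mem (C_mem hc0) (X_pow_mem _)) hF) ?_
        rw [mul_assoc, coeff_C_mul, coeff_X_pow_mul]
        exact hquiet _ (by omega) (by omega)
  have := main k
  rw [coeff_sub, coeff_C_mul] at this
  simp only [bitPoly]
  linarith

end nonnegPoly

/-! ### The noise -/

/-- A geometric series with ratio `x = exp (-(1 / t))`; from `exp (1 / t) ≥ 1 + 1 / t` one gets `1 /
(1 - x) ≤ t + 1`. -/
theorem sum_exp_neg_div_le (m : ℕ) {t : ℝ} (ht : 0 < t) :
    ∑ j ∈ Finset.range m, Real.exp (-(j / t)) ≤ t + 1 := by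
  have h1 : ∀ j : ℕ, Real.exp (-(j / t)) = Real.exp (-(1 / t)) ^ j := by
    intro j
    rw [← Real.exp_nat_mul]
    congr 1
    ring
  simp only [h1]
  set x := Real.exp (-(1 / t)) with hx
  have hx0 : 0 < x := Real.exp_pos _
  have hx1 : x * (1 + 1 / t) ≤ 1 := by
    have h2 := Real.add_one_le_exp (1 / t)
    have h3 : x * Real.exp (1 / t) = 1 := by
      rw [hx, ← Real.exp_add, neg_add_cancel, Real.exp_zero]
    nlinarith
  have hx2 : 1 ≤ (1 - x) * (t + 1) := by
    have : x * (t + 1) ≤ t := by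
      have h4 : x * (1 + 1 / t) * t = x * (t + 1) := by field_simp
      nlinarith
    linarith
  have h5 : (∑ j ∈ Finset.range m, x ^ j) * (1 - x) ≤ 1 := by
    have := geom_sum_mul x m
    have := pow_pos hx0 m
    linarith
  have h6 : 0 ≤ ∑ j ∈ Finset.range m, x ^ j := Finset.sum_nonneg fun _ _ => by positivity
  calc ∑ j ∈ Finset.range m, x ^ j ≤ (∑ j ∈ Finset.range m, x ^ j) * ((1 - x) * (t + 1)) :=
        le_mul_of_one_le_right h6 hx2
    _ = (∑ j ∈ Finset.range m, x ^ j) * (1 - x) * (t + 1) := by ring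
    _ ≤ 1 * (t + 1) := by gcongr
    _ = t + 1 := one_mul _

theorem sum_abs_sub_le (D : ℕ) (h : ℝ → ℝ) (hh : ∀ x, 0 ≤ h x) :
    ∑ i ∈ Finset.range (2 * D + 1), h |(i : ℝ) - D|
      ≤ 2 * ∑ j ∈ Finset.range (D + 1), h j := by
  have h1 : ∑ i ∈ Finset.range (2 * D + 1), h |(i : ℝ) - D|
      = ∑ i ∈ Finset.range D, h |(i : ℝ) - D| + ∑ j ∈ Finset.range (D + 1), h j := by
    rw [show 2 * D + 1 = D + (D + 1) by ring, Finset.sum_range_add]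
    congr 1
    refine Finset.sum_congr rfl fun j _ => ?_
    push_cast
    rw [add_sub_cancel_left, abs_of_nonneg (Nat.cast_nonneg j)]
  have h2 : ∑ i ∈ Finset.range D, h |(i : ℝ) - D| ≤ ∑ j ∈ Finset.range (D + 1), h j := by
    rw [← Finset.sum_range_reflect, Finset.sum_range_succ']
    have : ∑ j ∈ Finset.range D, h |((D - 1 - j : ℕ) : ℝ) - D|
        = ∑ j ∈ Finset.range D, h ((j + 1 : ℕ) : ℝ) := by
      refine Finset.sum_congr rfl fun j hj => ?_
      rw [Finset.mem_range] at hj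
      congr 1
      rw [Nat.sub_sub, Nat.cast_sub (by omega), abs_sub_comm]
      push_cast
      rw [abs_of_nonneg (by linarith [(Nat.cast_nonneg j : (0 : ℝ) ≤ j)])]
      ring
    rw [this]
    linarith [hh ((0 : ℕ) : ℝ)]
  linarith

/-- The unnormalized noise density: it decays at rate `1 / r` up to distance `E` and at rate
`2 / r` further out. -/
def noiseWeight (E r : ℕ) (x : ℝ) : ℝ := Real.exp (-(max |x| (2 * |x| - E) / r))

theorem noiseWeight_pos (E r : ℕ) (x : ℝ) : 0 < noiseWeight E r x := Real.exp_pos _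

/-- The exponent is piecewise linear in `|x|` with slopes `1` and `2`, so a unit step changes it by
at most `2 / r`. -/
theorem noiseWeight_le_mul {E r : ℕ} {x y : ℝ} (h : |y - x| ≤ 1) :
    noiseWeight E r x ≤ Real.exp (2 / r) * noiseWeight E r y := by
  have h1 : |y| ≤ |x| + 1 := by
    have := abs_add_le x (y - x)
    rw [add_sub_cancel] at this
    linarith
  have h2 : max |y| (2 * |y| - E) ≤ max |x| (2 * |x| - E) + 2 := by
    refine max_le ?_ ?_
    · linarith [le_max_left |x| (2 * |x| - E)]
    · linarith [le_max_right |x| (2 * |x| - E)]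
  rw [noiseWeight, noiseWeight, ← Real.exp_add, Real.exp_le_exp, ← sub_nonneg]
  have h3 : 2 / (r : ℝ) + -(max |y| (2 * |y| - E) / r) - -(max |x| (2 * |x| - E) / r)
      = (max |x| (2 * |x| - E) + 2 - max |y| (2 * |y| - E)) / r := by ring
  rw [h3]
  exact div_nonneg (by linarith) (Nat.cast_nonneg r)

theorem noiseWeight_le_exp (E r : ℕ) (x : ℝ) : noiseWeight E r x ≤ Real.exp (-(|x| / r)) := by
  rw [noiseWeight, Real.exp_le_exp, neg_le_neg_iff]
  gcongr
  exact le_max_left _ _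

theorem noiseWeight_of_le {E r : ℕ} {x : ℝ} (h : |x| ≤ E) :
    noiseWeight E r x = Real.exp (-(|x| / r)) := by
  rw [noiseWeight, max_eq_left (by linarith)]

/-- The normalizing constant of the noise. -/
def noiseTotal (E r : ℕ) : ℝ :=
  ∑ i ∈ Finset.range (2 * (2 * E) + 1), noiseWeight E r ((i : ℝ) - (2 * E : ℕ))

theorem noiseTotal_le {E r : ℕ} (hr : 1 ≤ r) : noiseTotal E r ≤ 4 * r := by
  have hr' : (1 : ℝ) ≤ r := by exact_mod_cast hr
  calc noiseTotal E r
      ≤ ∑ i ∈ Finset.range (2 * (2 * E) + 1), Real.exp (-(|(i : ℝ) - (2 * E : ℕ)| / r)) :=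
        Finset.sum_le_sum fun i _ => noiseWeight_le_exp _ _ _
    _ ≤ 2 * ∑ j ∈ Finset.range (2 * E + 1), Real.exp (-((j : ℝ) / r)) :=
        sum_abs_sub_le (2 * E) (fun x => Real.exp (-(x / r))) fun x => (Real.exp_pos _).le
    _ ≤ 2 * (r + 1) := by
        gcongr
        exact sum_exp_neg_div_le _ (by linarith)
    _ ≤ 4 * r := by linarith

theorem le_noiseTotal {E r : ℕ} (hr : 1 ≤ r) (hE : r ≤ E) : r / 3 ≤ noiseTotal E r := by
  have hr' : (1 : ℝ) ≤ r := by exact_mod_cast hr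
  have hexp : (1 : ℝ) / 3 ≤ Real.exp (-1) := by
    rw [Real.exp_neg, ← one_div]
    exact one_div_le_one_div_of_le (Real.exp_pos _) (by linarith [Real.exp_one_lt_d9])
  have hsub : Finset.Ico (2 * E) (2 * E + r) ⊆ Finset.range (2 * (2 * E) + 1) := by
    intro i hi
    simp only [Finset.mem_Ico, Finset.mem_range] at hi ⊢
    omega
  calc (r : ℝ) / 3 = ∑ i ∈ Finset.Ico (2 * E) (2 * E + r), (1 : ℝ) / 3 := by simp; ring
    _ ≤ ∑ i ∈ Finset.Ico (2 * E) (2 * E + r), noiseWeight E r ((i : ℝ) - (2 * E : ℕ)) := by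
        refine Finset.sum_le_sum fun i hi => hexp.trans ?_
        rw [Finset.mem_Ico] at hi
        have h1 : ((2 * E : ℕ) : ℝ) ≤ i := by exact_mod_cast hi.1
        have h2 : (i : ℝ) ≤ (2 * E : ℕ) + r := by exact_mod_cast hi.2.le
        have h3 : |(i : ℝ) - (2 * E : ℕ)| ≤ r := by rw [abs_le]; constructor <;> linarith
        have h4 : (r : ℝ) ≤ E := by exact_mod_cast hE
        rw [noiseWeight_of_le (h3.trans h4), Real.exp_le_exp, neg_le_neg_iff]
        rw [div_le_one (by linarith)]
        exact h3
    _ ≤ noiseTotal E r := Finset.sum_le_sum_of_subset_of_nonneg hsub fun i _ _ =>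
        (noiseWeight_pos _ _ _).le

theorem sum_noiseWeight_mul_abs_le {E r : ℕ} (hr : 1 ≤ r) :
    ∑ i ∈ Finset.range (2 * (2 * E) + 1),
      noiseWeight E r ((i : ℝ) - (2 * E : ℕ)) * |(i : ℝ) - (2 * E : ℕ)| ≤ 12 * r ^ 2 := by
  have hr' : (1 : ℝ) ≤ r := by exact_mod_cast hr
  -- Half of the exponential decay absorbs the linear factor; the other half remains summable.
  have key : ∀ y : ℝ, 0 ≤ y → Real.exp (-(y / r)) * y ≤ 2 * r * Real.exp (-(y / (2 * r))) := by
    intro y hy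
    have h1 : Real.exp (-(y / r)) = Real.exp (-(y / (2 * r))) * Real.exp (-(y / (2 * r))) := by
      rw [← Real.exp_add]; congr 1; field_simp; ring
    have h2 : Real.exp (-(y / (2 * r))) * (y / (2 * r)) ≤ 1 := by
      have h3 := Real.add_one_le_exp (y / (2 * r))
      have h4 : Real.exp (-(y / (2 * r))) * Real.exp (y / (2 * r)) = 1 := by
        rw [← Real.exp_add, neg_add_cancel, Real.exp_zero]
      have := Real.exp_pos (-(y / (2 * r)))
      nlinarith
    calc Real.exp (-(y / r)) * y
        = Real.exp (-(y / (2 * r))) * (Real.exp (-(y / (2 * r))) * (y / (2 * r))) * (2 * r) := by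
          rw [h1]; field_simp
      _ ≤ Real.exp (-(y / (2 * r))) * 1 * (2 * r) := by gcongr
      _ = _ := by ring
  calc _ ≤ ∑ i ∈ Finset.range (2 * (2 * E) + 1),
        2 * r * Real.exp (-(|(i : ℝ) - (2 * E : ℕ)| / (2 * r))) := by
        refine Finset.sum_le_sum fun i _ => le_trans ?_ (key _ (abs_nonneg _))
        gcongr
        exact noiseWeight_le_exp _ _ _
    _ = 2 * r * ∑ i ∈ Finset.range (2 * (2 * E) + 1),
        Real.exp (-(|(i : ℝ) - (2 * E : ℕ)| / (2 * r))) := by rw [Finset.mul_sum]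
    _ ≤ 2 * r * (2 * ∑ j ∈ Finset.range (2 * E + 1), Real.exp (-((j : ℝ) / (2 * r)))) := by
        gcongr
        exact sum_abs_sub_le (2 * E) (fun x => Real.exp (-(x / (2 * r))))
          fun x => (Real.exp_pos _).le
    _ ≤ 2 * r * (2 * (2 * r + 1)) := by
        gcongr
        exact sum_exp_neg_div_le _ (by linarith)
    _ ≤ 12 * r ^ 2 := by nlinarith

open Polynomial in
/-- The generating polynomial of the noise, shifted by `2 * E`. -/
def noisePoly (E r : ℕ) : ℝ[X] :=
  ∑ i ∈ Finset.range (2 * (2 * E) + 1),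
    C (noiseWeight E r ((i : ℝ) - (2 * E : ℕ)) / noiseTotal E r) * X ^ i

theorem coeff_noisePoly (E r k : ℕ) : (noisePoly E r).coeff k =
    if k < 2 * (2 * E) + 1 then noiseWeight E r ((k : ℝ) - (2 * E : ℕ)) / noiseTotal E r
    else 0 := by
  rw [noisePoly, Polynomial.finsetSum_coeff]
  simp only [Polynomial.coeff_C_mul_X_pow, Finset.sum_ite_eq, Finset.mem_range]

theorem noiseTotal_pos (E r : ℕ) : 0 < noiseTotal E r :=
  Finset.sum_pos (fun i _ => noiseWeight_pos _ _ _) ⟨0, by simp⟩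

theorem eval_one_noisePoly (E r : ℕ) : (noisePoly E r).eval 1 = 1 := by
  rw [noisePoly, Polynomial.eval_finsetSum]
  simp only [Polynomial.eval_mul, Polynomial.eval_C, Polynomial.eval_pow, Polynomial.eval_X,
    one_pow, mul_one]
  rw [← Finset.sum_div]
  exact div_self (noiseTotal_pos E r).ne'

/-- The two decay rates exist for the sake of `sq_left` and `sq_right`. With `E = r * K`, the edge
at distance `2 * E` has weight `exp (-(3 * K))`, while two users at distance about `E` have joint
weight about `exp (-(2 * K))`. The gain `exp K` absorbs the normalization and `r / q` by `hqK`; a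
single rate would give no gain. -/
theorem isBitNoise_noisePoly {r K : ℕ} {q : ℝ} (hr : 1 ≤ r) (hK : 2 ≤ K)
    (hqK : 8 * (r : ℝ) ^ 2 ≤ q * Real.exp K) :
    nonnegPoly.IsBitNoise (2 * (r * K)) r q (1 / (32 * r))
      (Real.exp (-(3 * K)) / noiseTotal (r * K) r) (noisePoly (r * K) r) := by
  have hr' : (1 : ℝ) ≤ r := by exact_mod_cast hr
  have hr0 : (r : ℝ) ≠ 0 := by positivity
  set E := r * K with hE
  have hEr : (E : ℝ) = r * K := by rw [hE]; push_cast; ring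
  have hZ := noiseTotal_pos E r
  have hZ4 := noiseTotal_le (E := E) hr
  have hKr : r + r ≤ E := by rw [hE]; nlinarith
  have hmem : noisePoly E r ∈ nonnegPoly := by
    intro k
    rw [coeff_noisePoly]
    split_ifs
    · exact div_nonneg (noiseWeight_pos _ _ _).le hZ.le
    · exact le_rfl
  have hexp2 : Real.exp 2 ≤ 8 := by
    have h1 : Real.exp 2 = Real.exp 1 * Real.exp 1 := by rw [← Real.exp_add]; norm_num
    have h2 := Real.exp_one_lt_d9
    have h3 := Real.exp_pos 1
    rw [h1]
    nlinarith
  have hq : 0 < q := by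
    by_contra hq
    have : q * Real.exp K ≤ 0 := mul_nonpos_of_nonpos_of_nonneg (not_lt.1 hq) (Real.exp_pos _).le
    nlinarith
  -- a product of two coefficients at distance about `E` beats the coefficient at the edge
  have hsq : ∀ i j : ℕ, i < 2 * (2 * E) + 1 → j < 2 * (2 * E) + 1 →
      max |(i : ℝ) - (2 * E : ℕ)| (2 * |(i : ℝ) - (2 * E : ℕ)| - E) ≤ E →
      max |(j : ℝ) - (2 * E : ℕ)| (2 * |(j : ℝ) - (2 * E : ℕ)| - E) ≤ E + 2 →
      Real.exp (-(3 * K)) / noiseTotal E r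
        ≤ 4 * q / r * (noisePoly E r * noisePoly E r).coeff (i + j) := by
    intro i j hi hj hi' hj'
    have h1 : (noisePoly E r).coeff i * (noisePoly E r).coeff j
        ≤ (noisePoly E r * noisePoly E r).coeff (i + j) := by
      rw [Polynomial.coeff_mul]
      exact Finset.single_le_sum (f := fun x : ℕ × ℕ =>
        (noisePoly E r).coeff x.1 * (noisePoly E r).coeff x.2)
        (fun x _ => mul_nonneg (hmem _) (hmem _)) (Finset.HasAntidiagonal.mem_antidiagonal.2 rfl :
          (i, j) ∈ Finset.HasAntidiagonal.antidiagonal (i + j))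
    rw [coeff_noisePoly, coeff_noisePoly, if_pos hi, if_pos hj] at h1
    have h2 : Real.exp (-K) ≤ noiseWeight E r ((i : ℝ) - (2 * E : ℕ)) := by
      rw [noiseWeight, Real.exp_le_exp, neg_le_neg_iff, div_le_iff₀ (by linarith)]
      linarith
    have h3 : Real.exp (-(K + 2)) ≤ noiseWeight E r ((j : ℝ) - (2 * E : ℕ)) := by
      rw [noiseWeight, Real.exp_le_exp, neg_le_neg_iff, div_le_iff₀ (by linarith)]
      nlinarith
    have h4 : Real.exp (-K) * Real.exp (-(K + 2)) / noiseTotal E r ^ 2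
        ≤ (noisePoly E r * noisePoly E r).coeff (i + j) := by
      refine le_trans ?_ h1
      rw [div_mul_div_comm, ← sq]
      have := (noiseWeight_pos E r ((i : ℝ) - (2 * E : ℕ))).le
      gcongr
    refine le_trans ?_ (mul_le_mul_of_nonneg_left h4 (by positivity))
    have h6 : Real.exp (-(3 * (K : ℝ))) * Real.exp K
        = Real.exp (-K) * Real.exp (-(K + 2)) * Real.exp 2 := by
      simp only [← Real.exp_add]; congr 1; ring
    have h7 : 0 < Real.exp (K : ℝ) := Real.exp_pos _
    have h8 : noiseTotal E r * r * 2 ≤ q * Real.exp K := by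
      refine le_trans ?_ hqK
      nlinarith
    have h9 : 0 < Real.exp (-K) * Real.exp (-(K + 2 : ℝ)) := by positivity
    rw [div_mul_div_comm, div_le_div_iff₀ hZ (by positivity)]
    set u := Real.exp (-K) * Real.exp (-(K + 2 : ℝ)) with hu
    have h10 : Real.exp (-(3 * (K : ℝ))) * (noiseTotal E r * r * 2) ≤ u * 8 * q := by
      calc Real.exp (-(3 * (K : ℝ))) * (noiseTotal E r * r * 2)
          ≤ Real.exp (-(3 * (K : ℝ))) * (q * Real.exp K) := by gcongr
        _ = Real.exp (-(3 * (K : ℝ))) * Real.exp K * q := by ring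
        _ = u * Real.exp 2 * q := by rw [h6]
        _ ≤ u * 8 * q := by gcongr
    nlinarith
  refine ⟨hmem, ?_, ?_, ?_, ?_, ?_, ?_, ?_, ?_⟩
  · intro k hk
    rw [coeff_noisePoly, coeff_noisePoly, if_pos (by omega), if_pos (by omega), ← mul_div_assoc]
    gcongr
    refine noiseWeight_le_mul ?_
    push_cast
    rw [abs_le]
    constructor <;> linarith
  · intro k hk
    rw [coeff_noisePoly, coeff_noisePoly, if_pos (by omega), if_pos (by omega), ← mul_div_assoc]
    gcongr
    refine noiseWeight_le_mul ?_
    push_cast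
    rw [abs_le]
    constructor <;> linarith
  · rw [coeff_noisePoly, if_pos (by omega)]
    congr 1
    rw [noiseWeight]
    congr 2
    push_cast
    rw [zero_sub, abs_neg, abs_of_nonneg (by positivity), max_eq_right (by linarith), hEr]
    field_simp
    ring
  · rw [coeff_noisePoly, if_pos (by omega)]
    congr 1
    rw [noiseWeight]
    congr 2
    push_cast
    rw [abs_of_nonneg (by linarith), max_eq_right (by linarith), hEr]
    field_simp
    ring
  · intro k hk
    rw [coeff_noisePoly, if_neg (by omega)]
  · have := hsq E E (by omega) (by omega)
    rw [show E + E = 2 * E by ring] at this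
    have h1 : |(E : ℝ) - (2 * E : ℕ)| = E := by
      push_cast
      rw [show (E : ℝ) - 2 * E = -E by ring, abs_neg, abs_of_nonneg (by positivity)]
    rw [h1] at this
    exact this (max_le le_rfl (by linarith)) (max_le (by linarith) (by linarith))
  -- The target `6 * E + 1` is odd, so one index sits a unit further out, where the slope is `2`;
  -- hence the allowance `E + 2` in `hsq`.
  · have := hsq (3 * E) (3 * E + 1) (by omega) (by omega)
    rw [show 3 * E + (3 * E + 1) = 3 * (2 * E) + 1 by ring] at this
    have h1 : |((3 * E : ℕ) : ℝ) - (2 * E : ℕ)| = E := by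
      push_cast
      rw [show (3 : ℝ) * E - 2 * E = E by ring, abs_of_nonneg (by positivity)]
    have h2 : |((3 * E + 1 : ℕ) : ℝ) - (2 * E : ℕ)| = E + 1 := by
      push_cast
      rw [show (3 : ℝ) * E + 1 - 2 * E = E + 1 by ring, abs_of_nonneg (by positivity)]
    rw [h1, h2] at this
    exact this (max_le le_rfl (by linarith)) (max_le (by linarith) (by linarith))
  · intro k hk hk'
    rw [coeff_noisePoly, if_pos (by omega)]
    have h1 : ((2 * E : ℕ) : ℝ) ≤ k + r := by exact_mod_cast hk
    have h2 : (k : ℝ) ≤ (2 * E : ℕ) + r + 1 := by exact_mod_cast hk'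
    have h3 : |(k : ℝ) - (2 * E : ℕ)| ≤ r + 1 := by rw [abs_le]; constructor <;> linarith
    have h4 : (r : ℝ) + 1 ≤ E := by
      have : (r : ℝ) + r ≤ E := by exact_mod_cast hKr
      linarith
    -- Here the distance is at most `r + 1 ≤ 2 * r`, so the weight is at least `exp (-2) ≥ 1 / 8`;
    -- the normalization is at most `4 * r`.
    rw [noiseWeight_of_le (h3.trans h4)]
    have h5 : Real.exp (-2) ≤ Real.exp (-(|(k : ℝ) - (2 * E : ℕ)| / r)) := by
      rw [Real.exp_le_exp, neg_le_neg_iff, div_le_iff₀ (by linarith)]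
      linarith
    have h6 : 1 / 8 ≤ Real.exp (-2) := by
      rw [Real.exp_neg, ← one_div]
      exact one_div_le_one_div_of_le (Real.exp_pos _) hexp2
    calc 1 / (32 * (r : ℝ)) = (1 / 8) / (4 * r) := by field_simp; norm_num
      _ ≤ Real.exp (-(|(k : ℝ) - (2 * E : ℕ)| / r)) / noiseTotal E r := by
        gcongr
        exact h6.trans h5

/-! ### Summation of bits -/

/-- The properties of a randomizer for one bit, among `n` users: the numbers of messages are
bounded, the total number of messages is private, and the expected error of one user is small. -/
structure IsBitRandomizer (n s K : ℕ) (D : ℕ) (p : Bool → PMF ℕ) : Prop where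
  le_of_mem : ∀ b, ∀ k ∈ (p b).support, k ≤ 4 * s ^ 2 * K
  dp : ∀ y y' : Fin n → Bool, (∃ i, ∀ j, j ≠ i → y j = y' j) → ∀ k,
    (∏ i, p (y i)) k ≤ ENNReal.ofReal (Real.exp (4 / (s : ℝ) ^ 2)) * (∏ i, p (y' i)) k
  err : ∀ b, (p b).mean (fun k => ENNReal.ofReal |(k : ℝ) - (D + b.toNat : ℕ)|)
    ≤ ENNReal.ofReal (7400 * s ^ 3 / n)

theorem exists_isBitRandomizer {n s K : ℕ} (hs : 1 ≤ s) (hK : 2 ≤ K) (hn : 8 ≤ n)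
    (hsn : 200 * s ≤ n) (hexp : (s : ℝ) ^ 4 * n ≤ Real.exp K) :
    ∃ (D : ℕ) (p : Bool → PMF ℕ), IsBitRandomizer n s K D p := by
  have hs' : (1 : ℝ) ≤ s := by exact_mod_cast hs
  have hn' : (0 : ℝ) < n := by exact_mod_cast (by omega : 0 < n)
  have hsn' : 200 * (s : ℝ) ≤ n := by exact_mod_cast hsn
  set r := s ^ 2 with hr
  have hr1 : 1 ≤ r := Nat.one_le_pow _ _ hs
  have hrs : (r : ℝ) = (s : ℝ) ^ 2 := by rw [hr]; push_cast; rfl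
  have hr' : (1 : ℝ) ≤ r := by exact_mod_cast hr1
  set q : ℝ := 200 * s / n with hq
  have hqn : n * q = 200 * s := by rw [hq]; field_simp
  have hq0 : 0 ≤ q := by positivity
  have hq1 : q ≤ 1 := by rw [hq, div_le_one hn']; exact hsn'
  have hqK : 8 * (r : ℝ) ^ 2 ≤ q * Real.exp K := by
    calc 8 * (r : ℝ) ^ 2 = 8 * (s : ℝ) ^ 4 := by rw [hrs]; ring
      _ ≤ 200 * (s : ℝ) * (s : ℝ) ^ 4 := by gcongr; linarith
      _ = q * (s ^ 4 * n) := by rw [← hqn]; ring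
      _ ≤ q * Real.exp K := by gcongr
  have hN := isBitNoise_noisePoly hr1 hK hqK
  set D := 2 * (r * K) with hD
  set g := noisePoly (r * K) r with hg
  have hrK : r + r ≤ r * K := by nlinarith
  have hmem : ∀ b, nonnegPoly.bitPoly D q g b ∈ nonnegPoly :=
    nonnegPoly.bitPoly_mem hq0 hq1 hN.mem
  have heval : ∀ b, (nonnegPoly.bitPoly D q g b).eval 1 = 1 := by
    intro b
    rw [nonnegPoly.bitPoly]
    simp [hg, eval_one_noisePoly]
  have hzero : ∀ b k, b ≤ 1 → 2 * D < k → (nonnegPoly.bitPoly D q g b).coeff k = 0 := by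
    intro b k hb hk
    rw [nonnegPoly.bitPoly, Polynomial.coeff_add, Polynomial.coeff_C_mul_X_pow,
      Polynomial.coeff_C_mul, hN.coeff_of_lt k hk, if_neg (by omega)]
    simp
  refine ⟨D, fun b => nonnegPoly.law (nonnegPoly.bitPoly D q g b.toNat) (hmem _) (heval _),
    ⟨?_, ?_, ?_⟩⟩
  · intro b k hk
    by_contra hlt
    rw [PMF.mem_support_iff, nonnegPoly.law_apply, hzero _ _ (Bool.toNat_le b)] at hk
    · simp at hk
    · have : 2 * D = 4 * s ^ 2 * K := by rw [hD, hr]; ring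
      rw [this]
      exact not_le.1 hlt
  · rintro y y' ⟨i, hi⟩ k
    rw [nonnegPoly.conv_prod_apply Finset.univ (fun i => hmem (y i).toNat)
        fun i k => nonnegPoly.law_apply _ _ _ _,
      nonnegPoly.conv_prod_apply Finset.univ (fun i => hmem (y' i).toNat)
        fun i k => nonnegPoly.law_apply _ _ _ _,
      ← ENNReal.ofReal_mul (Real.exp_pos _).le]
    refine ENNReal.ofReal_le_ofReal ?_
    rw [← Finset.mul_prod_erase _ _ (Finset.mem_univ i),
      ← Finset.mul_prod_erase _ _ (Finset.mem_univ i)]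
    have hrest : ∏ j ∈ Finset.univ.erase i, nonnegPoly.bitPoly D q g (y' j).toNat
        = ∏ j ∈ Finset.univ.erase i, nonnegPoly.bitPoly D q g (y j).toNat :=
      Finset.prod_congr rfl fun j hj => by rw [hi j (Finset.ne_of_mem_erase hj)]
    rw [hrest, ← hrs]
    refine hN.private hq0 hq1 (by positivity) hr1 (by omega) hn ?_ _ (by simp) _
      (fun j => Bool.toNat_le _) _ _ (Bool.toNat_le _) (Bool.toNat_le _) k
    -- All powers of `s` cancel: `n * q * a` is a constant over `s`, and `r ^ 2 = s ^ 4`. With `m`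
    -- noisy users the corresponding quantity scales as `s ^ (m - 4)`, so four is the least number
    -- that works.
    rw [← mul_assoc, hqn, hrs]
    have hs0 : (s : ℝ) ≠ 0 := by positivity
    have : 2 * ((s : ℝ) ^ 2) ^ 2 * (200 * s * (1 / (32 * s ^ 2))) ^ 4 = 2 * (200 / 32) ^ 4 := by
      field_simp
    rw [this]
    norm_num
  · intro b
    have hb := Bool.toNat_le b
    have hb' : (b.toNat : ℝ) ≤ 1 := by exact_mod_cast hb
    have hb0 : (0 : ℝ) ≤ b.toNat := Nat.cast_nonneg _
    rw [PMF.mean, tsum_eq_sum (s := Finset.range (2 * D + 1))]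
    swap
    · intro k hk
      rw [Finset.mem_range] at hk
      rw [nonnegPoly.law_apply, hzero _ _ hb (by omega)]
      simp
    simp only [nonnegPoly.law_apply]
    simp_rw [← ENNReal.ofReal_mul (hmem _ _)]
    rw [← ENNReal.ofReal_sum_of_nonneg fun k _ => mul_nonneg (hmem _ k) (abs_nonneg _)]
    refine ENNReal.ofReal_le_ofReal ?_
    -- A user who is not noisy makes no error. The last summand accounts for the noise being centred
    -- at `D` rather than `D + b`.
    have hterm : ∀ k ∈ Finset.range (2 * D + 1),
        (nonnegPoly.bitPoly D q g b.toNat).coeff k * |(k : ℝ) - (D + b.toNat : ℕ)|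
          ≤ q * (noiseWeight (r * K) r ((k : ℝ) - D) / noiseTotal (r * K) r * |(k : ℝ) - D|
            + noiseWeight (r * K) r ((k : ℝ) - D) / noiseTotal (r * K) r) := by
      intro k hk
      rw [Finset.mem_range] at hk
      have hw : 0 ≤ noiseWeight (r * K) r ((k : ℝ) - D) / noiseTotal (r * K) r :=
        div_nonneg (noiseWeight_pos _ _ _).le (noiseTotal_pos _ _).le
      have h1 : (1 - q) * (if k = D + b.toNat then 1 else 0) * |(k : ℝ) - (D + b.toNat : ℕ)|
          = 0 := by
        split_ifs with h
        · rw [h, sub_self, abs_zero, mul_zero]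
        · ring
      rw [nonnegPoly.bitPoly, Polynomial.coeff_add, Polynomial.coeff_C_mul,
        Polynomial.coeff_C_mul, Polynomial.coeff_X_pow, add_mul, h1, zero_add, hg,
        coeff_noisePoly, if_pos hk, mul_assoc]
      refine mul_le_mul_of_nonneg_left ?_ hq0
      have h2 : |(k : ℝ) - (D + b.toNat : ℕ)| ≤ |(k : ℝ) - D| + 1 := by
        push_cast
        rw [← sub_sub]
        refine (abs_sub _ _).trans ?_
        rw [abs_of_nonneg hb0]
        linarith
      calc _ ≤ noiseWeight (r * K) r ((k : ℝ) - D) / noiseTotal (r * K) r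
            * (|(k : ℝ) - D| + 1) := mul_le_mul_of_nonneg_left h2 hw
        _ = _ := by ring
    refine (Finset.sum_le_sum hterm).trans ?_
    rw [← Finset.mul_sum, Finset.sum_add_distrib, ← Finset.sum_div]
    simp_rw [div_mul_eq_mul_div]
    rw [← Finset.sum_div]
    have h1 := sum_noiseWeight_mul_abs_le (E := r * K) hr1
    have h2 := le_noiseTotal hr1 (by omega : r ≤ r * K)
    have hZ := noiseTotal_pos (r * K) r
    have h3 : (∑ i ∈ Finset.range (2 * D + 1), noiseWeight (r * K) r ((i : ℝ) - D) *
        |(i : ℝ) - D|) / noiseTotal (r * K) r ≤ 36 * r := by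
      rw [div_le_iff₀ hZ]
      refine h1.trans ?_
      nlinarith
    have h4 : (∑ i ∈ Finset.range (2 * D + 1), noiseWeight (r * K) r ((i : ℝ) - D))
        / noiseTotal (r * K) r = 1 := div_self hZ.ne'
    rw [h4]
    calc _ ≤ q * (36 * r + r) := by gcongr
      _ = 7400 * s ^ 3 / n := by rw [hq, hrs]; ring

/-! ### Summation of real numbers -/

/-- Binary expansion: choose the leading bit `c` and recurse on `2 * x - c`, which is again in the
unit interval. At `x = 1` all bits may be 1, with error exactly `(1 / 2) ^ L`. -/
theorem exists_bits (L : ℕ) : ∀ x : ℝ, 0 ≤ x → x ≤ 1 → ∃ β : Fin L → Bool,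
    |∑ j, (1 / 2 : ℝ) ^ (j.val + 1) * (β j).toNat - x| ≤ (1 / 2) ^ L := by
  induction L with
  | zero =>
    intro x hx hx1
    refine ⟨fun _ => false, ?_⟩
    simp [abs_of_nonneg hx, hx1]
  | succ L ih =>
    intro x hx hx1
    obtain ⟨c, h0, h1⟩ : ∃ c : Bool, 0 ≤ 2 * x - c.toNat ∧ 2 * x - c.toNat ≤ 1 := by
      rcases le_total x (1 / 2) with h | h
      · exact ⟨false, by simp [hx], by simp; linarith⟩
      · exact ⟨true, by simp; linarith, by simp; linarith⟩
    obtain ⟨β, hβ⟩ := ih _ h0 h1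
    refine ⟨Fin.cons c β, ?_⟩
    rw [Fin.sum_univ_succ]
    simp only [Fin.cons_zero, Fin.cons_succ, Fin.val_zero, Fin.val_succ]
    have h2 : (1 / 2 : ℝ) ^ (0 + 1) * c.toNat
        + ∑ j : Fin L, (1 / 2 : ℝ) ^ (j.val + 1 + 1) * (β j).toNat - x
        = (1 / 2) * (∑ j : Fin L, (1 / 2 : ℝ) ^ (j.val + 1) * (β j).toNat
          - (2 * x - c.toNat)) := by
      have : ∑ j : Fin L, (1 / 2 : ℝ) ^ (j.val + 1 + 1) * (β j).toNat
          = (1 / 2) * ∑ j : Fin L, (1 / 2 : ℝ) ^ (j.val + 1) * (β j).toNat := by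
        rw [Finset.mul_sum]
        exact Finset.sum_congr rfl fun j _ => by ring
      rw [this]
      ring
    rw [h2, abs_mul, abs_of_nonneg (by norm_num : (0 : ℝ) ≤ 1 / 2), pow_succ, mul_comm]
    gcongr

/-- The total weight of a multiset of messages. -/
def totalWeight {M : Type*} (w : M → ℝ) : Multiset M →+ ℝ :=
  Multiset.sumAddMonoidHom.comp (Multiset.mapAddMonoidHom w)

theorem totalWeight_nsmul_singleton {M : Type*} (w : M → ℝ) (k : ℕ) (m : M) :
    totalWeight w (multiplesHom (Multiset M) {m} k) = k * w m := by
  rw [multiplesHom_apply, map_nsmul, nsmul_eq_mul]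
  simp [totalWeight]

/-- Summation of the bits of the inputs, separately for every significance, with independent
private randomness. -/
theorem exists_protocol {n L K b : ℕ} {ε : ℝ} (s : Fin L → ℕ) (hn : 8 ≤ n) (hL : L ≤ 2 ^ b)
    (hK : 2 ≤ K) (hs : ∀ j, 1 ≤ s j) (hsn : ∀ j, 200 * s j ≤ n)
    (hexp : ∀ j, (s j : ℝ) ^ 4 * n ≤ Real.exp K) (hε : ∑ j, 4 / (s j : ℝ) ^ 2 ≤ ε) :
    ∃ P : ShuffledProtocol (Set.Icc (0 : ℝ) 1) (Fin b → Bool),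
      P.SendsAtMost (∑ j, 4 * s j ^ 2 * K) ∧ P.IsShuffledDP n ε ∧
      ∀ x : Fin n → Set.Icc (0 : ℝ) 1, P.expectedError x (∑ i, (x i : ℝ))
        ≤ ENNReal.ofReal (7400 * ∑ j : Fin L, (1 / 2 : ℝ) ^ (j.val + 1) * (s j : ℝ) ^ 3
          + n * (1 / 2) ^ L) := by
  choose D p hp using fun j => exists_isBitRandomizer (hs j) hK hn (hsn j) (hexp j)
  choose β hβ using fun x : Set.Icc (0 : ℝ) 1 => exists_bits L x x.2.1 x.2.2
  obtain ⟨tag⟩ : Nonempty (Fin L ↪ (Fin b → Bool)) :=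
    Function.Embedding.nonempty_of_card_le (by simpa using hL)
  set w : Fin L → ℝ := fun j => (1 / 2) ^ (j.val + 1) with hw
  have hw0 : ∀ j, 0 ≤ w j := fun j => by positivity
  -- Bit strings that tag no significance get weight 0.
  set φ := totalWeight (Function.extend tag w 0) with hφ
  have hφtag : ∀ j k, φ (multiplesHom (Multiset (Fin b → Bool)) {tag j} k) = k * w j := by
    intro j k
    rw [hφ, totalWeight_nsmul_singleton, tag.injective.extend_apply]
  set ρ : Set.Icc (0 : ℝ) 1 → PMF (Multiset (Fin b → Bool)) := fun x =>
    ∏ j, PMF.mapHom (multiplesHom _ {tag j}) (p j (β x j)) with hρ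
  set W : ℝ := ∑ j, w j * D j with hW
  -- Each user's weighted count is offset by `W`, whatever the input; the analyzer removes the `n`
  -- offsets.
  let P : ShuffledProtocol (Set.Icc (0 : ℝ) 1) (Fin b → Bool) :=
    ⟨fun x => (ρ x).map Multiset.toList, fun l => φ l - n * W⟩
  have hcoe : ∀ x, (P.randomizer x).map (fun k : List _ => (k : Multiset (Fin b → Bool)))
      = ρ x := by
    intro x
    change ((ρ x).map Multiset.toList).map _ = ρ x
    rw [PMF.map_comp]
    convert PMF.map_id (ρ x)
    funext s
    exact Multiset.coe_toList s
  refine ⟨P, ?_, ?_, ?_⟩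
  · intro x l hl
    obtain ⟨a, ha, rfl⟩ := (PMF.mem_support_map_iff _ _ _).1 hl
    rw [Multiset.length_toList]
    refine PMF.card_le_of_mem_support_prod _ _ _ (fun j _ c hc => ?_) a ha
    obtain ⟨k, hk, rfl⟩ := (PMF.mem_support_map_iff _ _ _).1 hc
    simpa using (hp j).le_of_mem _ k hk
  · refine P.isShuffledDP_of_multiset n ε ?_
    rintro x x' ⟨i, hi⟩ a
    simp only [hcoe, hρ]
    -- Grouping by significance instead of by user turns the view into a product of independent
    -- one-bit protocols, whose privacy factors multiply.
    rw [Finset.prod_comm, Finset.prod_comm (f := fun i j =>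
      PMF.mapHom (multiplesHom (Multiset (Fin b → Bool)) {tag j}) (p j (β (x' i) j)))]
    simp only [← map_prod]
    have hprod : ∏ j, ENNReal.ofReal (Real.exp (4 / (s j : ℝ) ^ 2))
        ≤ ENNReal.ofReal (Real.exp ε) := by
      rw [← ENNReal.ofReal_prod_of_nonneg fun _ _ => (Real.exp_pos _).le, ← Real.exp_sum]
      exact ENNReal.ofReal_le_ofReal (Real.exp_le_exp.2 hε)
    refine (PMF.prod_le_mul Finset.univ
      (c := fun j => ENNReal.ofReal (Real.exp (4 / (s j : ℝ) ^ 2))) (fun j _ c => ?_) a).trans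
      (mul_le_mul_left hprod _)
    exact PMF.map_le_mul ((hp j).dp _ _ ⟨i, fun k hk => by rw [hi k hk]⟩) _ c
  · intro x
    have huser : ∀ y, (ρ y).mean (fun a => ENNReal.ofReal |φ a - (y + W)|)
        ≤ ENNReal.ofReal (∑ j, w j * (7400 * (s j : ℝ) ^ 3 / n) + (1 / 2) ^ L) := by
      intro y
      have h1 : ∀ a, ENNReal.ofReal |φ a - (y + W)|
          ≤ ENNReal.ofReal |φ a - ∑ j, w j * (D j + (β y j).toNat : ℕ)|
            + ENNReal.ofReal ((1 / 2) ^ L) := by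
        intro a
        rw [← ENNReal.ofReal_add (abs_nonneg _) (by positivity)]
        refine ENNReal.ofReal_le_ofReal ?_
        have h2 : φ a - (y + W) = (φ a - ∑ j, w j * (D j + (β y j).toNat : ℕ))
            + (∑ j, w j * (β y j).toNat - y) := by
          simp only [Nat.cast_add, mul_add, Finset.sum_add_distrib, hW]
          ring
        rw [h2]
        exact (abs_add_le _ _).trans (add_le_add le_rfl (hβ y))
      refine (PMF.mean_mono _ fun a _ => h1 a).trans ?_
      rw [PMF.mean_add, PMF.mean_const, ENNReal.ofReal_add
        (Finset.sum_nonneg fun j _ => mul_nonneg (hw0 j) (by positivity)) (by positivity)]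
      refine add_le_add ?_ le_rfl
      refine (PMF.mean_abs_prod_le _ _ _ _).trans ?_
      rw [ENNReal.ofReal_sum_of_nonneg fun j _ => mul_nonneg (hw0 j) (by positivity)]
      refine Finset.sum_le_sum fun j _ => ?_
      rw [PMF.mapHom_apply, PMF.mean_map]
      simp only [hφtag]
      have h3 : ∀ k : ℕ, ENNReal.ofReal |(k : ℝ) * w j - w j * (D j + (β y j).toNat : ℕ)|
          = ENNReal.ofReal (w j) * ENNReal.ofReal |(k : ℝ) - (D j + (β y j).toNat : ℕ)| := by
        intro k
        rw [mul_comm, ← mul_sub, abs_mul, abs_of_nonneg (hw0 j), ENNReal.ofReal_mul (hw0 j)]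
      simp only [h3]
      rw [PMF.mean_mul_left, ENNReal.ofReal_mul (hw0 j)]
      exact mul_le_mul_right ((hp j).err _) _
    rw [P.expectedError_eq x _ (fun a => φ a - n * W) fun _ => rfl]
    simp only [hcoe]
    have h4 : ∀ a, φ a - n * W - ∑ i, (x i : ℝ) = φ a - ∑ i, ((x i : ℝ) + W) := by
      intro a
      rw [Finset.sum_add_distrib, Finset.sum_const, Finset.card_univ, Fintype.card_fin,
        nsmul_eq_mul]
      ring
    simp only [h4]
    refine (PMF.mean_abs_prod_le _ _ _ _).trans ((Finset.sum_le_sum fun i _ =>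
      huser (x i)).trans ?_)
    have hn0 : (n : ℝ) ≠ 0 := by
      have : n ≠ 0 := by omega
      exact_mod_cast this
    rw [Finset.sum_const, Finset.card_univ, Fintype.card_fin, ← ENNReal.ofReal_nsmul,
      nsmul_eq_mul]
    refine ENNReal.ofReal_le_ofReal (le_of_eq ?_)
    rw [mul_add, Finset.mul_sum, Finset.mul_sum]
    congr 1
    refine Finset.sum_congr rfl fun j _ => ?_
    field_simp
    simp only [hw]
    ring

/-- The protocol without any messages. -/
theorem exists_trivial_protocol (n : ℕ) {ε : ℝ} (hε : 0 < ε) :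
    ∃ P : ShuffledProtocol (Set.Icc (0 : ℝ) 1) (Fin 0 → Bool),
      P.SendsAtMost 0 ∧ P.IsShuffledDP n ε ∧
      ∀ x : Fin n → Set.Icc (0 : ℝ) 1,
        P.expectedError x (∑ i, (x i : ℝ)) ≤ ENNReal.ofReal n := by
  refine ⟨⟨fun _ => PMF.pure [], fun _ => 0⟩, ?_, ?_, ?_⟩
  · intro x l hl
    rw [PMF.mem_support_pure_iff] at hl
    simp [hl]
  · refine ShuffledProtocol.isShuffledDP_of_multiset _ _ _ fun x x' _ a => ?_
    refine le_mul_of_one_le_left zero_le ?_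
    rw [← ENNReal.ofReal_one]
    exact ENNReal.ofReal_le_ofReal (Real.one_le_exp hε.le)
  · intro x
    rw [ShuffledProtocol.expectedError_eq _ x _ (fun _ => 0) fun _ => rfl, PMF.mean_const]
    refine ENNReal.ofReal_le_ofReal ?_
    rw [zero_sub, abs_neg, abs_of_nonneg (Finset.sum_nonneg fun i _ => (x i).2.1)]
    calc ∑ i, (x i : ℝ) ≤ ∑ _i : Fin n, (1 : ℝ) := Finset.sum_le_sum fun i _ => (x i).2.2
      _ = n := by simp

/-! ### Choice of parameters -/

theorem clog_two_le {m : ℕ} (hm : 1 ≤ m) : (Nat.clog 2 m : ℝ) ≤ 1 + 2 * Real.log m := by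
  rcases hm.eq_or_lt with rfl | hm
  · simp
  have h1 : 2 ^ (Nat.clog 2 m).pred < m := Nat.pow_pred_clog_lt_self (by norm_num) hm
  have h2 : 1 ≤ Nat.clog 2 m := Nat.clog_pos (by norm_num) hm
  have h3 : Real.log ((2 : ℝ) ^ (Nat.clog 2 m).pred) ≤ Real.log m :=
    Real.log_le_log (by positivity) (by exact_mod_cast h1.le)
  rw [Real.log_pow, Nat.pred_eq_sub_one, Nat.cast_sub h2, Nat.cast_one] at h3
  have h4 := Real.log_two_gt_d9
  have h5 : (1 : ℝ) ≤ Nat.clog 2 m := by exact_mod_cast h2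
  nlinarith

theorem sum_fin_pow_le {a : ℝ} (ha : 0 ≤ a) (ha1 : a < 1) (L : ℕ) :
    ∑ j : Fin L, a ^ j.val ≤ 1 / (1 - a) := by
  rw [Fin.sum_univ_eq_sum_range (fun j => a ^ j) L, le_div_iff₀ (by linarith)]
  have := geom_sum_mul a L
  have := pow_nonneg ha L
  linarith

/-- A choice of the noise levels of the bits, with bounds for the total privacy loss, the total
number of messages and the total error. -/
theorem exists_noise_levels {L : ℕ} (hL : 1 ≤ L) {ε : ℝ} (hε : 0 < ε) (hε1 : ε < 1) :
    ∃ s : Fin L → ℕ, (∀ j, 1 ≤ s j) ∧ (∀ j, (s j : ℝ) ^ 2 ≤ 49 * (L / ε)) ∧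
      ∑ j, 4 / (s j : ℝ) ^ 2 ≤ ε ∧
      ∑ j : Fin L, (1 / 2 : ℝ) ^ (j.val + 1) * (s j : ℝ) ^ 3 ≤ 686 / ε ^ (3 / 2 : ℝ) := by
  have hL' : (1 : ℝ) ≤ L := by exact_mod_cast hL
  set t : ℝ := 1 / Real.sqrt ε with ht
  have hsq : 0 < Real.sqrt ε := Real.sqrt_pos.2 hε
  have ht1 : 1 ≤ t := by
    rw [ht, le_div_iff₀ hsq, one_mul]
    exact Real.sqrt_le_one.2 hε1.le
  have ht2 : t ^ 2 = 1 / ε := by rw [ht, div_pow, Real.sq_sqrt hε.le, one_pow]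
  have ht3 : t ^ 3 = 1 / ε ^ (3 / 2 : ℝ) := by
    rw [ht, div_pow, one_pow, Real.sqrt_eq_rpow, ← Real.rpow_natCast, ← Real.rpow_mul hε.le]
    norm_num
  have hsL : 1 ≤ Real.sqrt L := Real.one_le_sqrt.2 hL'
  have hpow : ∀ j : ℕ, (1 : ℝ) ≤ (10 / 9) ^ j := fun j => one_le_pow₀ (by norm_num)
  -- The ratio `10 / 9` exceeds 1, so the losses, proportional to `y j ^ (-2)`, are summable, and
  -- its cube is below 2, so the weighted errors are too. The cap `√L` bounds the number of
  -- messages; the capped terms lose at most `ε / (9 * L)` each.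
  set y : Fin L → ℝ := fun j => t * min ((10 / 9 : ℝ) ^ j.val) (Real.sqrt L) with hy
  have hy1 : ∀ j, 1 ≤ y j := fun j => by
    have : 1 ≤ min ((10 / 9 : ℝ) ^ j.val) (Real.sqrt L) := le_min (hpow _) hsL
    calc (1 : ℝ) = 1 * 1 := (one_mul 1).symm
      _ ≤ y j := mul_le_mul ht1 this zero_le_one (by linarith)
  have hlow : ∀ j, 6 * y j ≤ (⌈6 * y j⌉₊ : ℝ) := fun j => Nat.le_ceil _
  have hupp : ∀ j, (⌈6 * y j⌉₊ : ℝ) ≤ 7 * y j := fun j => by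
    have := Nat.ceil_lt_add_one (by linarith [hy1 j] : 0 ≤ 6 * y j)
    linarith [hy1 j]
  refine ⟨fun j => ⌈6 * y j⌉₊, fun j => ?_, fun j => ?_, ?_, ?_⟩
  · have h1 := hlow j
    have h2 := hy1 j
    have : (1 : ℝ) ≤ (⌈6 * y j⌉₊ : ℝ) := by linarith
    exact_mod_cast this
  · calc (⌈6 * y j⌉₊ : ℝ) ^ 2 ≤ (7 * (t * Real.sqrt L)) ^ 2 := by
          refine pow_le_pow_left₀ (Nat.cast_nonneg _) ((hupp j).trans ?_) 2
          have : y j ≤ t * Real.sqrt L :=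
            mul_le_mul_of_nonneg_left (min_le_right _ _) (by linarith)
          linarith
      _ = 49 * (t ^ 2 * Real.sqrt L ^ 2) := by ring
      _ = 49 * (L / ε) := by rw [ht2, Real.sq_sqrt (by linarith)]; ring
  · have hterm : ∀ j : Fin L, 4 / (⌈6 * y j⌉₊ : ℝ) ^ 2
        ≤ ε / 9 * ((81 / 100 : ℝ) ^ j.val + 1 / L) := by
      intro j
      have h1 : 4 / (⌈6 * y j⌉₊ : ℝ) ^ 2 ≤ 4 / (6 * y j) ^ 2 := by
        have := hy1 j
        gcongr
        exact hlow j
      refine h1.trans ?_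
      have h2 : 0 ≤ ε / 9 * (81 / 100 : ℝ) ^ j.val := by positivity
      have h3 : 0 ≤ ε / 9 * (1 / L) := by positivity
      rcases min_choice ((10 / 9 : ℝ) ^ j.val) (Real.sqrt L) with h | h
      · have : 4 / (6 * y j) ^ 2 = ε / 9 * (81 / 100 : ℝ) ^ j.val := by
          have h4 : (6 * y j) ^ 2 = 36 * (t ^ 2 * ((10 / 9 : ℝ) ^ 2) ^ j.val) := by
            rw [hy]
            simp only [h]
            rw [← pow_mul, mul_comm 2, pow_mul]
            ring
          have h5 : (81 / 100 : ℝ) = ((10 / 9 : ℝ) ^ 2)⁻¹ := by norm_num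
          rw [h4, ht2, h5, inv_pow]
          have : ((10 / 9 : ℝ) ^ 2) ^ j.val ≠ 0 := by positivity
          field_simp
          norm_num
        linarith
      · have : 4 / (6 * y j) ^ 2 = ε / 9 * (1 / L) := by
          have h4 : (6 * y j) ^ 2 = 36 * (t ^ 2 * Real.sqrt L ^ 2) := by
            rw [hy]
            simp only [h]
            ring
          rw [h4, ht2, Real.sq_sqrt (by linarith)]
          field_simp
          norm_num
        linarith
    refine (Finset.sum_le_sum fun j _ => hterm j).trans ?_
    rw [← Finset.mul_sum, Finset.sum_add_distrib, Finset.sum_const, Finset.card_univ,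
      Fintype.card_fin, nsmul_eq_mul, mul_one_div_cancel (by positivity)]
    have := sum_fin_pow_le (by norm_num : (0 : ℝ) ≤ 81 / 100) (by norm_num) L
    norm_num at this
    nlinarith
  · have hterm : ∀ j : Fin L, (1 / 2 : ℝ) ^ (j.val + 1) * (⌈6 * y j⌉₊ : ℝ) ^ 3
        ≤ 343 / 2 * t ^ 3 * (500 / 729 : ℝ) ^ j.val := by
      intro j
      calc (1 / 2 : ℝ) ^ (j.val + 1) * (⌈6 * y j⌉₊ : ℝ) ^ 3
          ≤ (1 / 2 : ℝ) ^ (j.val + 1) * (7 * (t * (10 / 9 : ℝ) ^ j.val)) ^ 3 := by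
            gcongr
            refine (hupp j).trans ?_
            have : y j ≤ t * (10 / 9 : ℝ) ^ j.val :=
              mul_le_mul_of_nonneg_left (min_le_left _ _) (by linarith)
            linarith
        _ = 343 / 2 * t ^ 3 * ((1 / 2) * (10 / 9 : ℝ) ^ 3) ^ j.val := by
            rw [mul_pow _ _ j.val, ← pow_mul, mul_comm 3, pow_mul]
            ring
        _ = 343 / 2 * t ^ 3 * (500 / 729 : ℝ) ^ j.val := by norm_num
    refine (Finset.sum_le_sum fun j _ => hterm j).trans ?_
    rw [← Finset.mul_sum]
    have h1 := sum_fin_pow_le (by norm_num : (0 : ℝ) ≤ 500 / 729) (by norm_num) L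
    have h2 : ∑ j : Fin L, (500 / 729 : ℝ) ^ j.val ≤ 4 := h1.trans (by norm_num)
    have h3 : 0 ≤ t ^ 3 := by positivity
    calc _ ≤ 343 / 2 * t ^ 3 * 4 := by gcongr
      _ = 686 / ε ^ (3 / 2 : ℝ) := by rw [ht3]; ring

theorem exists_large_enough : ∃ n₀ : ℕ, ∀ n : ℕ, n₀ ≤ n →
    2 ≤ Real.log (Real.log n) ∧ 6000000 * Real.log n ≤ n := by
  have h1 : Filter.Tendsto (fun n : ℕ => Real.log (Real.log n)) Filter.atTop Filter.atTop :=
    Real.tendsto_log_atTop.comp (Real.tendsto_log_atTop.comp tendsto_natCast_atTop_atTop)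
  have h2 := (Real.isLittleO_log_id_atTop.comp_tendsto
    tendsto_natCast_atTop_atTop).bound (c := 1 / 6000000) (by norm_num)
  obtain ⟨n₀, h⟩ := Filter.eventually_atTop.1 ((h1.eventually_ge_atTop 2).and h2)
  refine ⟨n₀, fun n hn => ⟨(h n hn).1, ?_⟩⟩
  have h3 := (h n hn).2
  simp only [Function.comp, id, Real.norm_eq_abs, Nat.abs_cast] at h3
  linarith [le_abs_self (Real.log n)]

end

theorem theorem5p1 :
    ∃ C : ℝ, 0 < C ∧ ∃ n₀ : ℕ, ∀ n : ℕ, n₀ ≤ n → ∀ ε : ℝ, 0 < ε → ε < 1 →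
      ∃ m b : ℕ,
        (m : ℝ) ≤ C * (Real.log n ^ 3 / ε) ∧
        (b : ℝ) ≤ C * Real.log (Real.log n) ∧
        ∃ P : ShuffledProtocol (Set.Icc (0 : ℝ) 1) (Fin b → Bool),
          P.SendsAtMost m ∧
          P.IsShuffledDP n ε ∧
          ∀ x : Fin n → Set.Icc (0 : ℝ) 1,
            P.expectedError x (∑ i, (x i : ℝ))
              ≤ ENNReal.ofReal (C * (Real.sqrt (Real.log (2 / ε)) / ε ^ (3 / 2 : ℝ))) := by
  obtain ⟨n₀, hn₀⟩ := exists_large_enough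
  refine ⟨20000000, by norm_num, n₀, fun n hn ε hε hε1 => ?_⟩
  obtain ⟨hll, hln⟩ := hn₀ n hn
  have hlog3 : (3 : ℝ) ≤ Real.log n := by
    have h0 : 0 < Real.log n := by
      by_contra h0
      have hneg : Real.log n = 0 := le_antisymm (not_lt.1 h0) (Real.log_natCast_nonneg n)
      rw [hneg, Real.log_zero] at hll
      linarith
    have := Real.add_one_le_exp (Real.log (Real.log n))
    rw [Real.exp_log h0] at this
    linarith
  have hn8' : (8 : ℝ) ≤ n := by linarith
  have hn8 : 8 ≤ n := by exact_mod_cast hn8'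
  -- the error bound dominates `1 / ε ^ (3 / 2)`
  have hsqrt : 1 / 2 ≤ Real.sqrt (Real.log (2 / ε)) := by
    refine Real.le_sqrt_of_sq_le ?_
    have h1 : Real.log 2 ≤ Real.log (2 / ε) :=
      Real.log_le_log (by norm_num) (by rw [le_div_iff₀ hε]; linarith)
    have := Real.log_two_gt_d9
    norm_num
    linarith
  have hpow : 0 < ε ^ (3 / 2 : ℝ) := Real.rpow_pos_of_pos hε _
  have herr : 10000000 / ε ^ (3 / 2 : ℝ)
      ≤ 20000000 * (Real.sqrt (Real.log (2 / ε)) / ε ^ (3 / 2 : ℝ)) := by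
    rw [← mul_div_assoc]
    gcongr
    linarith
  have hpow1 : ε ^ (3 / 2 : ℝ) ≤ ε := by
    have := Real.rpow_le_rpow_of_exponent_ge hε hε1.le (by norm_num : (1 : ℝ) ≤ 3 / 2)
    rwa [Real.rpow_one] at this
  rcases lt_or_ge (ε * n) 1 with hsmall | hlarge
  -- When `n < 1 / ε`, answering 0 is accurate enough.
  · obtain ⟨P, h1, h2, h3⟩ := exists_trivial_protocol n hε
    refine ⟨0, 0, ?_, ?_, P, h1, h2, fun x => (h3 x).trans (ENNReal.ofReal_le_ofReal ?_)⟩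
    · rw [Nat.cast_zero]; positivity
    · rw [Nat.cast_zero]; linarith
    · refine le_trans ?_ herr
      rw [le_div_iff₀ hpow]
      nlinarith
  · set L := Nat.clog 2 n with hLdef
    have hLpos : 1 ≤ L := Nat.clog_pos (by norm_num) (by omega)
    have hL3 : (L : ℝ) ≤ 3 * Real.log n := by
      have := clog_two_le (by omega : 1 ≤ n)
      linarith
    obtain ⟨s, hs1, hs2, hsε, hserr⟩ := exists_noise_levels hLpos hε hε1
    -- The factor 5 gives `exp K ≥ n ^ 5`, which suffices for `s j ^ 4 * n` because `s j ≤ n`.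
    set K := ⌈5 * Real.log n⌉₊ with hKdef
    have hKlow : 5 * Real.log n ≤ K := Nat.le_ceil _
    have hKupp : (K : ℝ) ≤ 6 * Real.log n := by
      have := Nat.ceil_lt_add_one (by linarith : 0 ≤ 5 * Real.log n)
      linarith
    have hK2 : 2 ≤ K := by
      have : (2 : ℝ) ≤ K := by linarith
      exact_mod_cast this
    have hsn : ∀ j, 200 * (s j : ℝ) ≤ n := by
      intro j
      refine le_of_sq_le_sq ?_ (by linarith)
      have h1 : (L : ℝ) / ε ≤ L * n := by
        rw [div_le_iff₀ hε]
        nlinarith [(Nat.cast_nonneg L : (0 : ℝ) ≤ L)]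
      calc (200 * (s j : ℝ)) ^ 2 = 40000 * (s j : ℝ) ^ 2 := by ring
        _ ≤ 40000 * (49 * ((L : ℝ) * n)) := by linarith [hs2 j]
        _ ≤ 40000 * (49 * ((3 * Real.log n) * n)) := by gcongr
        -- The constant is `40000 * 49 * 3 = 5880000`, hence the threshold `6000000` in
        -- `exists_large_enough`.
        _ ≤ (n : ℝ) ^ 2 := by nlinarith
    have hexp : ∀ j, (s j : ℝ) ^ 4 * n ≤ Real.exp K := by
      intro j
      have h1 : (s j : ℝ) ≤ n := by
        have := hsn j
        have : (0 : ℝ) ≤ s j := Nat.cast_nonneg _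
        linarith
      calc (s j : ℝ) ^ 4 * n ≤ (n : ℝ) ^ 4 * n := by gcongr
        _ = Real.exp (5 * Real.log n) := by
            rw [← pow_succ, show (5 : ℝ) = (5 : ℕ) by norm_num, Real.exp_nat_mul,
              Real.exp_log (by linarith)]
        _ ≤ Real.exp K := Real.exp_le_exp.2 hKlow
    obtain ⟨P, h1, h2, h3⟩ := exists_protocol (b := Nat.clog 2 L) s hn8
      (Nat.le_pow_clog (by norm_num) L) hK2 hs1 (fun j => by exact_mod_cast hsn j)
      hexp hsε
    refine ⟨_, _, ?_, ?_, P, h1, h2, fun x => (h3 x).trans (ENNReal.ofReal_le_ofReal ?_)⟩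
    · push_cast
      calc ∑ j, 4 * (s j : ℝ) ^ 2 * K ≤ ∑ _j : Fin L, 4 * (49 * (L / ε)) * (K : ℝ) := by
            gcongr with j
            exact hs2 j
        _ = 196 * (L * L * K / ε) := by
            rw [Finset.sum_const, Finset.card_univ, Fintype.card_fin, nsmul_eq_mul]
            ring
        _ ≤ 196 * ((3 * Real.log n) * (3 * Real.log n) * (6 * Real.log n) / ε) := by gcongr
        _ = 10584 * (Real.log n ^ 3 / ε) := by ring
        _ ≤ _ := by
            have : 0 ≤ Real.log n ^ 3 / ε := by positivity
            linarith
    · have h4 := clog_two_le hLpos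
      have h5 : Real.log L ≤ Real.log 3 + Real.log (Real.log n) := by
        rw [← Real.log_mul (by norm_num) (by linarith)]
        exact Real.log_le_log (by exact_mod_cast hLpos) hL3
      have h6 : Real.log 3 ≤ 2 := by
        have := Real.log_le_sub_one_of_pos (by norm_num : (0 : ℝ) < 3)
        linarith
      linarith
    · refine le_trans ?_ herr
      -- With this `L`, rounding all `n` inputs costs at most 1 in total.
      have h4 : (n : ℝ) * (1 / 2) ^ L ≤ 1 := by
        have h5 : (n : ℝ) ≤ 2 ^ L := by exact_mod_cast Nat.le_pow_clog (by norm_num) n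
        calc (n : ℝ) * (1 / 2) ^ L ≤ 2 ^ L * (1 / 2) ^ L := by gcongr
          _ = 1 := by rw [← mul_pow]; norm_num
      have h5 : 1 ≤ 1 / ε ^ (3 / 2 : ℝ) := by
        rw [le_div_iff₀ hpow]
        linarith
      calc _ ≤ 7400 * (686 / ε ^ (3 / 2 : ℝ)) + 1 / ε ^ (3 / 2 : ℝ) := by
            gcongr
            exact h4.trans h5
        _ = 5076401 * (1 / ε ^ (3 / 2 : ℝ)) := by ring
        _ ≤ 10000000 * (1 / ε ^ (3 / 2 : ℝ)) := by linarith
        _ = 10000000 / ε ^ (3 / 2 : ℝ) := by ring
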